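/- **Theorem 4.** Let $N\ge 1$, let $\mathbb X\subseteq\mathbb R^{N\times N}$ be compact and convex with $0$ in its interior, and let $c\in\mathbb R^{N\times N}$. Write $c'\zeta=\sum_{i,j}c_{ij}\zeta_{ij}$. For $\varepsilon\in[0,1]$ and $m\in\mathbb N$ put $$\beta(\varepsilon,m)=\sum_{\ell=0}^{N^2-1}\binom{m}{\ell}\varepsilon^{\ell}(1-\varepsilon)^{m-\ell},\qquad m(\varepsilon,\beta)=\min\{m\in\mathbb N:\ \beta(\varepsilon,m)\le\beta\}.$$ Whenever $c'\zeta$ is minimized over a set, "the solution" is the minimizer, where ties are broken by taking the minimizer that is lexicographically smallest in its entries (read row by row). **(a) Random convex program.** Let $(\Omega,\mathcal F,\mathcal P)$ be a probability space, $\gamma\in\mathbb R$, and let $f:\mathbb X\times\Omega\to\mathbb R$ be measurable, and convex and lower semicontinuous in its first argument. Assume that some $\zeta_0\in\mathbb X$ satisfies $f(\zeta_0,\omega)\le\gamma$ for almost every $\omega$. Let $V(\zeta)=\mathcal P\{\omega: f(\zeta,\omega)>\gamma\}$ be the violation probability. For i.i.d. observations $\omega_1,\dots,\omega_m$ with law $\mathcal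 P$, let $\hat\zeta_m$ be the solution of $$\min_{\zeta\in\mathbb X} c'\zeta\quad\text{s.t.}\quad f(\zeta,\omega_t)\le\gamma,\ \ t=1,\dots,m.$$ If $m\ge N^2$, then $\hat\zeta_m$ exists and is unique almost surely, and for every $\varepsilon\in[0,1]$ $$\mathcal P^m\{V(\hat\zeta_m)>\varepsilon\}\le\beta(\varepsilon,m).$$ **(b) Estimation of the appraisal matrix.** Let $\Lambda=\mathrm{diag}(\varrho_1,\dots,\varrho_N)$ be a real diagonal matrix, $\mathcal L\in\mathbb R^{N\times N}$, $\mathcal D\in\mathbb X$ (the appraisal matrix to be estimated), and let $Q$ be symmetric positive definite. Let $(x_t,y_t)$, $t=1,\dots,m$, be i.i.d. random pairs of consecutive opinion vectors in $\mathbb R^N$ with law $\mathcal P$, where almost surely $y_t=(I-\Lambda\mathcal L\mathcal D)x_t$. For a pair $(x,y)$ let $X_\zeta(x,y)=y-x+(x'\otimes\Lambda\mathcal L)\,\mathrm{vec}(\zeta)=y-x+\Lambda\mathcal L\zeta x$ and $g_\zeta=X_\zeta'QX_\zeta$. Let $\gamma^\star$ be the optimal value of $$\min_{\zeta,\gamma}\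 \gamma\quad\text{s.t.}\quad \frac1m\sum_{t=1}^m g_\zeta(x_t,y_t)\le\gamma,\quad \gamma\ge0,$$ and let $\hat\zeta_m$ be the solution of $$\min_{\zeta\in\mathbb X} c'\zeta\quad\text{s.t.}\quad \frac1m\sum_{t=1}^m g_\zeta(x_t,y_t)\le\gamma^\star .$$ For $\zeta\in\mathbb X$ let $V(\zeta)=\mathcal P\{(x,y): g_\zeta(x,y)>\gamma^\star\}$. If $m\ge N^2$, then $\hat\zeta_m$ exists and is unique almost surely, and for every $\varepsilon\in[0,1]$ $$\mathcal P^m\{V(\hat\zeta_m)>\varepsilon\}\le\beta(\varepsilon,m).$$ **(c) Number of observations.** For all $\varepsilon\in(0,1]$ and $\beta\in(0,1)$ the minimum $m(\varepsilon,\beta)$ exists, and in (a) and (b) one has $\mathcal P^m\{V(\hat\zeta_m)>\varepsilon\}\le\beta$ for every $m\ge m(\varepsilon,\beta)$. -/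

import Mathlib

open MeasureTheory

noncomputable section

/-- The product (that is, Borel) σ-algebra on real `N × N` matrices. -/
instance matrixMeasurableSpace (N : ℕ) : MeasurableSpace (Matrix (Fin N) (Fin N) ℝ) :=
  inferInstanceAs (MeasurableSpace (Fin N → Fin N → ℝ))

/-! ### Optimization over `N × N` matrices with a deterministic tie-break -/

/-- The linear cost `c' ζ` of a decision matrix `ζ` (with `N²` scalar decision variables). -/
def linearCost {N : ℕ} (c ζ : Matrix (Fin N) (Fin N) ℝ) : ℝ :=
  ∑ i, ∑ j, c i j * ζ i j

/-- `ζ` is strictly preferred to `ζ'`: it has a smaller cost or, at equal cost, it comes first in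
the lexicographic order of the entries (read row by row). -/
def Preferred {N : ℕ} (c ζ ζ' : Matrix (Fin N) (Fin N) ℝ) : Prop :=
  linearCost c ζ < linearCost c ζ' ∨
    (linearCost c ζ = linearCost c ζ' ∧
      ∃ i j, ζ i j < ζ' i j ∧
        ∀ i' j', (i' < i ∨ (i' = i ∧ j' < j)) → ζ i' j' = ζ' i' j')

/-- `ζ` is the solution of `min c' ζ` subject to `ζ ∈ S`; if several points of `S` attain the
minimum, it is the lexicographically smallest of them. -/
def IsSolution {N : ℕ} (c : Matrix (Fin N) (Fin N) ℝ) (S : Set (Matrix (Fin N) (Fin N) ℝ))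
    (ζ : Matrix (Fin N) (Fin N) ℝ) : Prop :=
  ζ ∈ S ∧ ∀ ζ' ∈ S, ¬ Preferred c ζ' ζ

/-! ### Random convex programs -/

/-- The probability of violation `P {ω : f(ζ, ω) > γ}`. -/
def violationProb {N : ℕ} {Ω : Type*} [MeasurableSpace Ω] (P : Measure Ω)
    (f : Matrix (Fin N) (Fin N) ℝ → Ω → ℝ) (γ : ℝ) (ζ : Matrix (Fin N) (Fin N) ℝ) : ℝ :=
  P.real {ω | γ < f ζ ω}

/-- The points of `X` that satisfy the `m` sampled constraints `f(ζ, ω_t) ≤ γ`. -/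
def sampledFeasible {N m : ℕ} {Ω : Type*} (X : Set (Matrix (Fin N) (Fin N) ℝ))
    (f : Matrix (Fin N) (Fin N) ℝ → Ω → ℝ) (γ : ℝ) (s : Fin m → Ω) :
    Set (Matrix (Fin N) (Fin N) ℝ) :=
  {ζ | ζ ∈ X ∧ ∀ t, f ζ (s t) ≤ γ}

/-! ### Estimation of the appraisal matrix -/

/-- One observation of the opinion process: the pair `(ξ(k-1), ξ(k))` of consecutive opinion
vectors of the `N` agents. -/
abbrev Observation (N : ℕ) : Type := (Fin N → ℝ) × (Fin N → ℝ)

/-- The residual `ξ(k) - ξ(k-1) + (ξ(k-1)' ⊗ ΛL) vec ζ = ξ(k) - ξ(k-1) + Λ L ζ ξ(k-1)`,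
where `Λ = diag ρ`. -/
def opinionResidual {N : ℕ} (ρ : Fin N → ℝ) (L ζ : Matrix (Fin N) (Fin N) ℝ) (z : Observation N) :
    Fin N → ℝ :=
  z.2 - z.1 + (Matrix.diagonal ρ * L * ζ).mulVec z.1

/-- The weighted squared residual `g = X' Q X`. -/
def appraisalLoss {N : ℕ} (ρ : Fin N → ℝ) (L Q ζ : Matrix (Fin N) (Fin N) ℝ)
    (z : Observation N) : ℝ :=
  opinionResidual ρ L ζ z ⬝ᵥ Q.mulVec (opinionResidual ρ L ζ z)

/-- The empirical loss `(1/m) ∑ₜ g(t)`. -/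
def empiricalLoss {N m : ℕ} (ρ : Fin N → ℝ) (L Q : Matrix (Fin N) (Fin N) ℝ)
    (s : Fin m → Observation N) (ζ : Matrix (Fin N) (Fin N) ℝ) : ℝ :=
  (1 / (m : ℝ)) * ∑ t, appraisalLoss ρ L Q ζ (s t)

/-- The optimal value `γ⋆` of: minimize `γ` subject to `(1/m) ∑ₜ g(t) ≤ γ`, `γ ≥ 0`. -/
def optimalLevel {N m : ℕ} (ρ : Fin N → ℝ) (L Q : Matrix (Fin N) (Fin N) ℝ)
    (s : Fin m → Observation N) : ℝ :=
  sInf {γ : ℝ | 0 ≤ γ ∧ ∃ ζ, empiricalLoss ρ L Q s ζ ≤ γ}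

/-- The matrices of `X` whose empirical loss is at most the optimal level `γ⋆`. -/
def appraisalFeasible {N m : ℕ} (X : Set (Matrix (Fin N) (Fin N) ℝ)) (ρ : Fin N → ℝ)
    (L Q : Matrix (Fin N) (Fin N) ℝ) (s : Fin m → Observation N) :
    Set (Matrix (Fin N) (Fin N) ℝ) :=
  {ζ | ζ ∈ X ∧ empiricalLoss ρ L Q s ζ ≤ optimalLevel ρ L Q s}

/-! ### The bound and the sample size -/

/-- The binomial tail `∑_{ℓ = 0}^{N² - 1} (m choose ℓ) ε^ℓ (1 - ε)^(m - ℓ)`. For `ℓ > m` the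
binomial coefficient vanishes. -/
def tailBound (N : ℕ) (ε : ℝ) (m : ℕ) : ℝ :=
  ∑ ℓ ∈ Finset.range (N ^ 2), (m.choose ℓ : ℝ) * ε ^ ℓ * (1 - ε) ^ (m - ℓ)

/-- The smallest `m` with `tailBound N ε m ≤ β`. -/
def sampleSize (N : ℕ) (ε β : ℝ) : ℕ :=
  sInf {m : ℕ | tailBound N ε m ≤ β}

end

/-! Put `d = N ^ 2`. Suppose first that the objective is strictly convex, that a fixed decision
almost surely leaves the constraint of an observation not exactly tight, and that observations carry
almost surely distinct real labels. By Helly's theorem at most `d` constraints determine the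
minimizer; in this situation the tight constraints alone determine it, and there are at most `d` of
them. Completing them by the observations with the smallest labels gives exactly one `d`-subset `J`
of the sample that is unviolated: every other observation satisfies its constraint at the solution
for `J`, and none has a label below that of a slack member of `J`.

Let `w` be the probability that a new observation does not violate a random `d`-sample. In a sample
of size `d + k` the events "`J` is unviolated" almost surely form a partition, there are `(d +
k).choose d` of them, and each has probability `E[w ^ k]`. Hence `E[w ^ k] = 1 / (d + k).choose d`
for all `k`. These are the moments of the density `d (1 - x) ^ (d - 1)` on the unit interval, and
moments determine a law there. Summing over the subsets of a sample of size `m` bounds the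
probability by `m.choose d` times the integral of `x ^ (m - d)` against this law over `x ≤ 1 - ε`,
which is the binomial tail (`measure_exists_unviolated_le`,
`measure_violation_le_of_nondegenerate`).

The general case is a limit of this one. Relaxing each constraint by a small multiple of an
independent uniform variable, which also serves as label, removes degeneracy
(`measure_violation_le_of_strictConvexOn`). Lexicographic tie-breaking is approximated by adding
small multiples of later objectives to earlier ones (`measure_violation_lexArgmin_le`). In both
limits the approximate solutions converge, and lower semicontinuity keeps a strict violation at the
limit visible along the sequence (`measure_violation_le_of_limit`).

For the appraisal matrix, the true matrix has zero loss on almost every observation, so the optimal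
level is almost surely `0`, and a vanishing mean of nonnegative losses means that every loss
vanishes. This is a random convex program at level `0`. -/

/-! ### Binomial tails -/

/-- The probability that a binomial variable with parameters `m` and `ε` is less than `d`. -/
def binomTail (d : ℕ) (ε : ℝ) (m : ℕ) : ℝ :=
  ∑ ℓ ∈ Finset.range d, (m.choose ℓ : ℝ) * ε ^ ℓ * (1 - ε) ^ (m - ℓ)

/-- The derivatives of the summands telescope, since `(m.choose (d + 1)) (d + 1) = (m.choose d) (m -
d)`; only the boundary term survives. The variable is `1 - ε`, the probability of no violation. -/
theorem hasDerivAt_binomTail_one_sub {d m : ℕ} (h : d ≤ m) (x : ℝ) :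
    HasDerivAt (fun x => binomTail d (1 - x) m)
      (d * m.choose d * ((1 - x) ^ (d - 1) * x ^ (m - d))) x := by
  induction d with
  | zero => simpa [binomTail] using hasDerivAt_const x (0 : ℝ)
  | succ d ih =>
    have h1 : HasDerivAt (fun x : ℝ => (m.choose d : ℝ) * (1 - x) ^ d * x ^ (m - d))
        ((m.choose d : ℝ) * (d * (1 - x) ^ (d - 1) * (-1)) * x ^ (m - d)
          + (m.choose d : ℝ) * (1 - x) ^ d * ((m - d : ℕ) * x ^ (m - d - 1))) x :=
      ((((hasDerivAt_id x).const_sub 1).pow d).const_mul _).mul (hasDerivAt_pow (m - d) x)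
    have h2 := (ih (by omega)).add h1
    have h3 : ((m.choose (d + 1) : ℝ)) * (d + 1) = m.choose d * (m - d : ℕ) := by
      exact_mod_cast Nat.choose_succ_right_eq m d
    refine (h2.congr_deriv ?_).congr_of_eventuallyEq (.of_forall fun y => ?_)
    · have e : m - (d + 1) = m - d - 1 := by omega
      rw [e, Nat.add_sub_cancel]
      push_cast
      linear_combination (-(1 - x) ^ d * x ^ (m - d - 1)) * h3
    · simp [binomTail, Finset.sum_range_succ]

theorem binomTail_one {d m : ℕ} (h : d ≤ m) : binomTail d 1 m = 0 := by
  refine Finset.sum_eq_zero fun ℓ hℓ => ?_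
  have : m - ℓ ≠ 0 := by have := Finset.mem_range.1 hℓ; omega
  simp [this]

theorem binomTail_zero {d : ℕ} (hd : 0 < d) (m : ℕ) : binomTail d 0 m = 1 := by
  rw [binomTail, Finset.sum_eq_single_of_mem 0 (by simpa using hd)]
  · simp
  · intro b _ hb; simp [hb]

theorem integral_beta_eq_binomTail {d m : ℕ} (h : d ≤ m) (y : ℝ) :
    ∫ x in (0 : ℝ)..y, (d * m.choose d * ((1 - x) ^ (d - 1) * x ^ (m - d)) : ℝ)
      = binomTail d (1 - y) m := by
  rw [intervalIntegral.integral_eq_sub_of_hasDerivAt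
    (fun x _ => hasDerivAt_binomTail_one_sub h x)
    (Continuous.intervalIntegrable (by fun_prop) _ _)]
  simp [binomTail_one h]

theorem binomTail_eq_one {d m : ℕ} (h : m < d) (ε : ℝ) : binomTail d ε m = 1 := by
  have h1 : binomTail d ε m = binomTail (m + 1) ε m := by
    refine (Finset.sum_subset (by simpa using h) fun ℓ _ hℓ => ?_).symm
    rw [Nat.choose_eq_zero_of_lt (by simpa using hℓ)]; simp
  calc binomTail d ε m = binomTail (m + 1) ε m := h1
    _ = (ε + (1 - ε)) ^ m := by
      rw [add_pow]; exact Finset.sum_congr rfl fun ℓ _ => by ring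
    _ = 1 := by simp

theorem binomTail_succ (d : ℕ) (ε : ℝ) (m : ℕ) : binomTail (d + 1) ε m
    = binomTail d ε m + (m.choose d : ℝ) * ε ^ d * (1 - ε) ^ (m - d) :=
  Finset.sum_range_succ _ _

theorem binomTail_mono {ε : ℝ} (hε : ε ∈ Set.Icc (0 : ℝ) 1) (d m : ℕ) :
    binomTail d ε m ≤ binomTail (d + 1) ε m := by
  have h1 := hε.1
  have h2 : 0 ≤ 1 - ε := by linarith [hε.2]
  rw [binomTail_succ]
  have : 0 ≤ (m.choose d : ℝ) * ε ^ d * (1 - ε) ^ (m - d) := by positivity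
  linarith

/-- Condition on the outcome of one trial; Pascal's rule is the algebraic form. -/
theorem binomTail_succ_succ (d : ℕ) (ε : ℝ) (m : ℕ) :
    binomTail (d + 1) ε (m + 1) = ε * binomTail d ε m + (1 - ε) * binomTail (d + 1) ε m := by
  induction d with
  | zero => simp [binomTail, pow_succ, mul_comm]
  | succ d ih =>
    rw [binomTail_succ (d + 1) ε (m + 1), ih, binomTail_succ (d + 1) ε m, binomTail_succ d ε m,
      Nat.choose_succ_succ, Nat.add_sub_add_right]
    push_cast
    rcases lt_or_ge d m with h | h
    · have e2 : m - d = m - (d + 1) + 1 := by omega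
      rw [e2, Nat.succ_eq_add_one]; ring
    · rw [Nat.succ_eq_add_one, Nat.choose_eq_zero_of_lt (show m < d + 1 by omega)]
      simp; ring

theorem binomTail_antitone {ε : ℝ} (hε : ε ∈ Set.Icc (0 : ℝ) 1) (d : ℕ) :
    Antitone (binomTail d ε) := by
  refine antitone_nat_of_succ_le fun m => ?_
  cases d with
  | zero => simp [binomTail]
  | succ d =>
    rw [binomTail_succ_succ]
    nlinarith [binomTail_mono hε d m, hε.1]

theorem tendsto_binomTail {ε : ℝ} (hε : ε ∈ Set.Ioc (0 : ℝ) 1) (d : ℕ) :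
    Filter.Tendsto (binomTail d ε) Filter.atTop (nhds 0) := by
  have : Filter.Tendsto (fun m => ∑ ℓ ∈ Finset.range d,
      (m.choose ℓ : ℝ) * ε ^ ℓ * (1 - ε) ^ (m - ℓ)) Filter.atTop
      (nhds (∑ ℓ ∈ Finset.range d, 0)) := by
    refine tendsto_finsetSum _ fun ℓ _ => ?_
    -- With `m = n + ℓ` the summand is `ε ^ ℓ` times the general term of a convergent series, `(n +
    -- ℓ).choose ℓ * (1 - ε) ^ n`.
    rw [← Filter.tendsto_add_atTop_iff_nat ℓ]
    have hr : ‖1 - ε‖ < 1 := by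
      rw [Real.norm_eq_abs, abs_lt]; constructor <;> linarith [hε.1, hε.2]
    have h := ((summable_choose_mul_geometric_of_norm_lt_one ℓ hr).tendsto_atTop_zero).mul_const
      (ε ^ ℓ)
    rw [zero_mul] at h
    refine h.congr fun n => ?_
    rw [Nat.add_sub_cancel]; ring
  rw [Finset.sum_const_zero] at this
  exact this

theorem isLeast_sampleSize (N : ℕ) {ε β : ℝ} (hε : ε ∈ Set.Ioc (0 : ℝ) 1)
    (hβ : β ∈ Set.Ioo (0 : ℝ) 1) :
    IsLeast {m : ℕ | tailBound N ε m ≤ β} (sampleSize N ε β) := by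
  have hne : {m : ℕ | tailBound N ε m ≤ β}.Nonempty :=
    (((tendsto_binomTail hε (N ^ 2)).eventually (gt_mem_nhds hβ.1)).mono
      fun m hm => le_of_lt hm).exists
  exact ⟨Nat.sInf_mem hne, fun m hm => Nat.sInf_le hm⟩

theorem tailBound_le_of_sampleSize_le {N m : ℕ} {ε β : ℝ} (hε : ε ∈ Set.Ioc (0 : ℝ) 1)
    (hβ : β ∈ Set.Ioo (0 : ℝ) 1) (h : sampleSize N ε β ≤ m) : tailBound N ε m ≤ β :=
  (binomTail_antitone ⟨hε.1.le, hε.2⟩ (N ^ 2) h).trans (isLeast_sampleSize N hε hβ).1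

/-- With fewer than `N ^ 2` observations the tail is the full binomial sum `1`, which exceeds `β`.
-/
theorem sq_le_of_sampleSize_le {N m : ℕ} {ε β : ℝ} (hε : ε ∈ Set.Ioc (0 : ℝ) 1)
    (hβ : β ∈ Set.Ioo (0 : ℝ) 1) (h : sampleSize N ε β ≤ m) : N ^ 2 ≤ m := by
  by_contra! hlt
  have h1 := tailBound_le_of_sampleSize_le hε hβ h
  have h2 : tailBound N ε m = 1 := binomTail_eq_one hlt ε
  linarith [hβ.2]

/-! ### Moments on the unit interval -/

open scoped unitInterval in
/-- A finite measure on the unit interval is determined by its moments. -/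
theorem MeasureTheory.Measure.ext_of_integral_pow {μ ν : Measure I} [IsFiniteMeasure μ]
    [IsFiniteMeasure ν] (h : ∀ k : ℕ, ∫ x, (x : ℝ) ^ k ∂μ = ∫ x, (x : ℝ) ^ k ∂ν) : μ = ν := by
  have hint (ρ : Measure I) [IsFiniteMeasure ρ] (g : C(I, ℝ)) : Integrable g ρ :=
    (BoundedContinuousFunction.mkOfCompact g).integrable ρ
  have hcont (ρ : Measure I) [IsFiniteMeasure ρ] :
      Continuous fun g : C(I, ℝ) => ∫ x, g x ∂ρ := by
    refine Metric.continuous_iff.2 fun g r hr => ?_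
    refine ⟨r / (ρ.real Set.univ + 1), by positivity, fun g' hg' => ?_⟩
    rw [dist_eq_norm, ← integral_sub (hint ρ g') (hint ρ g)]
    have hb : ‖∫ x, (g' x - g x) ∂ρ‖ ≤ dist g' g * ρ.real Set.univ :=
      norm_integral_le_of_norm_le_const (.of_forall fun x => by
        rw [← dist_eq_norm]; exact ContinuousMap.dist_apply_le_dist x)
    have h0 : 0 ≤ ρ.real Set.univ := measureReal_nonneg
    have : dist g' g * (ρ.real Set.univ + 1) < r := (lt_div_iff₀ (by positivity)).1 hg'
    nlinarith [dist_nonneg (x := g') (y := g)]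
  -- Equality of the two integrals is closed in the uniform norm and holds for polynomials, so
  -- Weierstrass extends it to all continuous functions.
  have hclosed : IsClosed {g : C(I, ℝ) | ∫ x, g x ∂μ = ∫ x, g x ∂ν} :=
    isClosed_eq (hcont μ) (hcont ν)
  have hpoly : (polynomialFunctions I : Set C(I, ℝ)) ⊆
      {g : C(I, ℝ) | ∫ x, g x ∂μ = ∫ x, g x ∂ν} := by
    rintro g hg
    rw [SetLike.mem_coe, ← SetLike.mem_coe, polynomialFunctions_coe] at hg
    obtain ⟨p, rfl⟩ := hg
    have hterm (ρ : Measure I) [IsFiniteMeasure ρ] (n : ℕ) :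
        Integrable (fun x : I => p.coeff n * (x : ℝ) ^ n) ρ :=
      hint ρ ⟨fun x : I => p.coeff n * (x : ℝ) ^ n, by fun_prop⟩
    have hexp (ρ : Measure I) [IsFiniteMeasure ρ] :
        ∫ x, Polynomial.toContinuousMapOnAlgHom I p x ∂ρ
          = ∑ n ∈ p.support, p.coeff n * ∫ x, (x : ℝ) ^ n ∂ρ := by
      simp only [Polynomial.toContinuousMapOnAlgHom_apply, Polynomial.toContinuousMapOn_apply,
        Polynomial.toContinuousMap_apply, Polynomial.eval_eq_sum, Polynomial.sum]
      rw [integral_finsetSum _ fun n _ => hterm ρ n]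
      simp only [integral_const_mul]
    change ∫ x, Polynomial.toContinuousMapOnAlgHom I p x ∂μ
      = ∫ x, Polynomial.toContinuousMapOnAlgHom I p x ∂ν
    rw [hexp μ, hexp ν]
    simp only [h]
  refine ext_of_forall_integral_eq_of_IsFiniteMeasure fun g => ?_
  have hg : g.toContinuousMap ∈ (polynomialFunctions I).topologicalClosure := by
    rw [polynomialFunctions_closure_eq_top']; trivial
  exact hclosed.closure_subset_iff.2 hpoly hg

/-- The beta distribution with density `d (1 - x) ^ (d - 1)` on the unit interval. -/
noncomputable def betaUnit (d : ℕ) : Measure unitInterval :=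
  (volume : Measure unitInterval).withDensity
    fun x => ENNReal.ofReal (d * (1 - (x : ℝ)) ^ (d - 1))

/-- Up to the factor `(d + k).choose d`, the integrand is the derivative of the binomial tail in `1
- ε`. The case `ε = 0` gives the moments. -/
theorem setLIntegral_pow_betaUnit (d k : ℕ) {ε : ℝ} (hε : ε ∈ Set.Icc (0 : ℝ) 1) :
    ∫⁻ x in {x : unitInterval | (x : ℝ) ≤ 1 - ε}, ENNReal.ofReal ((x : ℝ) ^ k) ∂(betaUnit d)
      = ENNReal.ofReal (binomTail d ε (d + k) / (d + k).choose d) := by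
  have hS : MeasurableSet {x : unitInterval | (x : ℝ) ≤ 1 - ε} :=
    measurableSet_le measurable_subtype_coe measurable_const
  have hmeas : Measurable fun x : unitInterval => ENNReal.ofReal (d * (1 - (x : ℝ)) ^ (d - 1)) := by
    fun_prop
  rw [betaUnit, restrict_withDensity hS,
    lintegral_withDensity_eq_lintegral_mul _ hmeas (by fun_prop)]
  have hpt (x : unitInterval) : ((fun x : unitInterval =>
      ENNReal.ofReal (d * (1 - (x : ℝ)) ^ (d - 1))) * fun x : unitInterval =>
      ENNReal.ofReal ((x : ℝ) ^ k)) x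
      = (fun y : ℝ => ENNReal.ofReal (d * ((1 - y) ^ (d - 1) * y ^ k))) x := by
    have h1 : 0 ≤ 1 - (x : ℝ) := by linarith [x.2.2]
    rw [Pi.mul_apply, ← ENNReal.ofReal_mul (by positivity), mul_assoc]
  simp_rw [hpt]
  have hpre : {x : unitInterval | (x : ℝ) ≤ 1 - ε} = Subtype.val ⁻¹' Set.Iic (1 - ε) := rfl
  rw [hpre]
  refine (unitInterval.measurePreserving_coe.setLIntegral_comp_preimage_emb
    unitInterval.measurableEmbedding_coe
    (fun y : ℝ => ENNReal.ofReal (d * ((1 - y) ^ (d - 1) * y ^ k))) (Set.Iic (1 - ε))).trans ?_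
  rw [Measure.restrict_restrict measurableSet_Iic]
  have hset : Set.Iic (1 - ε) ∩ unitInterval = Set.Icc 0 (1 - ε) := by
    ext y
    simp only [Set.mem_inter_iff, Set.mem_Iic, Set.mem_Icc]
    constructor
    · rintro ⟨h1, h2, h3⟩; exact ⟨h2, h1⟩
    · rintro ⟨h1, h2⟩; exact ⟨h2, h1, by linarith [hε.1]⟩
  have h01 : 0 ≤ 1 - ε := by linarith [hε.2]
  rw [hset, ← ofReal_integral_eq_lintegral_ofReal]
  · rw [integral_Icc_eq_integral_Ioc, ← intervalIntegral.integral_of_le h01]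
    congr 1
    have hc : ((d + k).choose d : ℝ) ≠ 0 := by
      exact_mod_cast (Nat.choose_pos (Nat.le_add_right d k)).ne'
    have h := integral_beta_eq_binomTail (Nat.le_add_right d k) (1 - ε)
    rw [sub_sub_cancel, Nat.add_sub_cancel_left] at h
    rw [eq_div_iff hc, ← h, ← intervalIntegral.integral_mul_const]
    congr 1; ext y; ring
  · exact Continuous.integrableOn_Icc (by fun_prop)
  · filter_upwards [ae_restrict_mem measurableSet_Icc] with y hy
    have h1 := hy.1
    have h2 : 0 ≤ 1 - y := by linarith [hy.2, hε.1]
    show 0 ≤ (d : ℝ) * ((1 - y) ^ (d - 1) * y ^ k)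
    positivity

theorem lintegral_pow_betaUnit {d : ℕ} (hd : 0 < d) (k : ℕ) :
    ∫⁻ x : unitInterval, ENNReal.ofReal ((x : ℝ) ^ k) ∂(betaUnit d)
      = ((d + k).choose d : ENNReal)⁻¹ := by
  have h := setLIntegral_pow_betaUnit d k (ε := 0) (by simp)
  have hu : {x : unitInterval | (x : ℝ) ≤ 1 - 0} = Set.univ := by
    ext x; simpa using x.2.2
  have hc : (0 : ℝ) < (d + k).choose d := by
    exact_mod_cast Nat.choose_pos (Nat.le_add_right d k)
  rw [hu, Measure.restrict_univ, binomTail_zero hd, one_div, ENNReal.ofReal_inv_of_pos hc,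
    ENNReal.ofReal_natCast] at h
  exact h

theorem eq_betaUnit_of_lintegral_pow {d : ℕ} (hd : 0 < d) (μ : Measure unitInterval)
    [IsFiniteMeasure μ]
    (h : ∀ k : ℕ, ∫⁻ x, ENNReal.ofReal ((x : ℝ) ^ k) ∂μ = ((d + k).choose d : ENNReal)⁻¹) :
    μ = betaUnit d := by
  have hfin : IsFiniteMeasure (betaUnit d) := ⟨by
    have := lintegral_pow_betaUnit hd 0
    simp only [pow_zero, ENNReal.ofReal_one, lintegral_one] at this
    rw [this]; simp⟩
  refine Measure.ext_of_integral_pow fun k => ?_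
  have hnn (ρ : Measure unitInterval) : 0 ≤ᵐ[ρ] fun x : unitInterval => (x : ℝ) ^ k :=
    .of_forall fun x => pow_nonneg x.2.1 k
  have hm (ρ : Measure unitInterval) :
      AEStronglyMeasurable (fun x : unitInterval => (x : ℝ) ^ k) ρ :=
    Continuous.aestronglyMeasurable (by fun_prop)
  rw [integral_eq_lintegral_of_nonneg_ae (hnn _) (hm _),
    integral_eq_lintegral_of_nonneg_ae (hnn _) (hm _), h, lintegral_pow_betaUnit hd]

/-! ### Samples with a unique unviolated subset -/

section Compression

variable {Z : Type*} [MeasurableSpace Z] (P : Measure Z) [IsProbabilityMeasure P] {d : ℕ}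

/-- The part of a sample indexed by a finite set, in increasing order of the indices. -/
def subsample {m : ℕ} (s : Fin m → Z) (J : {J : Finset (Fin m) // J.card = d}) : Fin d → Z :=
  fun i => s (J.1.orderEmbOfFin J.2 i)

/-- No further observation of the sample is related by `W` to the subsample at `J`. -/
def Unviolated (W : Set ((Fin d → Z) × Z)) {m : ℕ} (s : Fin m → Z)
    (J : {J : Finset (Fin m) // J.card = d}) : Prop :=
  ∀ t ∉ J.1, (subsample s J, s t) ∉ W

/-- Permuting coordinates puts `J` first. Given the subsample `p`, the remaining `m - d`
observations are independent and each avoids the section of `W` at `p` with the same probability. -/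
theorem measure_subsample_unviolated {W : Set ((Fin d → Z) × Z)} (hW : MeasurableSet W)
    {A : Set (Fin d → Z)} (hA : MeasurableSet A) {m : ℕ}
    (J : {J : Finset (Fin m) // J.card = d}) :
    (Measure.pi fun _ : Fin m => P) {s | subsample s J ∈ A ∧ Unviolated W s J}
      = ∫⁻ p in A, (P {z | (p, z) ∉ W}) ^ (m - d) ∂(Measure.pi fun _ : Fin d => P) := by
  have hc : (J.1ᶜ).card = m - d := by rw [Finset.card_compl, J.2, Fintype.card_fin]
  set e := finSumEquivOfFinset J.2 hc
  let T : Set ((Fin d → Z) × (Fin (m - d) → Z)) := {q | q.1 ∈ A ∧ ∀ j, (q.1, q.2 j) ∉ W}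
  have hT : MeasurableSet T := by
    refine (measurable_fst hA).inter ?_
    have : {q : (Fin d → Z) × (Fin (m - d) → Z) | ∀ j, (q.1, q.2 j) ∉ W}
        = ⋂ j, {q | (q.1, q.2 j) ∈ Wᶜ} := by ext; simp
    change MeasurableSet {q : (Fin d → Z) × (Fin (m - d) → Z) | ∀ j, (q.1, q.2 j) ∉ W}
    rw [this]
    refine MeasurableSet.iInter fun j => ?_
    have hj : Measurable fun q : (Fin d → Z) × (Fin (m - d) → Z) => (q.1, q.2 j) := by fun_prop
    exact hj hW.compl
  have h1 := measurePreserving_piCongrLeft (α := fun _ : Fin m => Z) (fun _ : Fin m => P) e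
  have h2 := measurePreserving_sumPiEquivProdPi (X := fun _ : Fin d ⊕ Fin (m - d) => Z)
    (fun _ => P)
  have h3 := h2.comp h1.symm
  have hpre : {s | subsample s J ∈ A ∧ Unviolated W s J} =
      (MeasurableEquiv.sumPiEquivProdPi (fun _ : Fin d ⊕ Fin (m - d) => Z) ∘
        (MeasurableEquiv.piCongrLeft (fun _ : Fin m => Z) e).symm) ⁻¹' T := by
    ext s
    have ha : (MeasurableEquiv.sumPiEquivProdPi (fun _ : Fin d ⊕ Fin (m - d) => Z) ∘
        (MeasurableEquiv.piCongrLeft (fun _ : Fin m => Z) e).symm) s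
        = (subsample s J, fun j => s (e (Sum.inr j))) := rfl
    simp only [Set.mem_preimage, ha, Set.mem_ofPred_eq, T, Unviolated]
    refine and_congr_right fun _ => ⟨fun h j => h _ ?_, fun h t ht => ?_⟩
    · rw [finSumEquivOfFinset_inr]
      exact Finset.mem_compl.1 (Finset.orderEmbOfFin_mem _ _ _)
    · obtain ⟨j, rfl⟩ : ∃ j, e (Sum.inr j) = t := by
        obtain ⟨x, rfl⟩ := e.surjective t
        cases x with
        | inl i => exact absurd (Finset.orderEmbOfFin_mem J.1 J.2 i) ht
        | inr j => exact ⟨j, rfl⟩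
      exact h j
  rw [hpre, h3.measure_preimage hT.nullMeasurableSet, Measure.prod_apply hT, ← lintegral_indicator hA]
  refine lintegral_congr fun p => ?_
  by_cases hp : p ∈ A
  · rw [Set.indicator_of_mem hp]
    have : Prod.mk p ⁻¹' T = Set.univ.pi fun _ => {z | (p, z) ∉ W} := by
      ext q; simp [T, hp]
    rw [this, Measure.pi_pi]
    simp
  · rw [Set.indicator_of_notMem hp]
    have : Prod.mk p ⁻¹' T = ∅ := by ext q; simp [T, hp]
    simp [this]

theorem measurableSet_unviolated {W : Set ((Fin d → Z) × Z)} (hW : MeasurableSet W) {m : ℕ}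
    (J : {J : Finset (Fin m) // J.card = d}) :
    MeasurableSet {s : Fin m → Z | Unviolated W s J} := by
  have : {s : Fin m → Z | Unviolated W s J} = ⋂ t, ⋂ (_ : t ∉ J.1),
      (fun s => (subsample s J, s t)) ⁻¹' Wᶜ := by ext; simp [Unviolated]
  rw [this]
  refine MeasurableSet.iInter fun t => MeasurableSet.iInter fun _ => ?_
  have h : Measurable fun s : Fin m → Z => (subsample s J, s t) := by
    unfold subsample; fun_prop
  exact h hW.compl

/-- If almost every sample of size at least `d` has exactly one unviolated subsample of size `d`,
then the probability of violating it is distributed as the `d`-th smallest of `m` uniform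
variables. -/
theorem measure_exists_unviolated_le (hd : 0 < d) {W : Set ((Fin d → Z) × Z)}
    (hW : MeasurableSet W)
    (hex : ∀ m : ℕ, d ≤ m → ∀ᵐ s ∂(Measure.pi fun _ : Fin m => P),
      ∃! J : {J : Finset (Fin m) // J.card = d}, Unviolated W s J)
    {m : ℕ} (hm : d ≤ m) {ε : ℝ} (hε : ε ∈ Set.Icc (0 : ℝ) 1) :
    (Measure.pi fun _ : Fin m => P) {s | ∃ J : {J : Finset (Fin m) // J.card = d},
      Unviolated W s J ∧ ε < P.real {z | (subsample s J, z) ∈ W}}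
      ≤ ENNReal.ofReal (binomTail d ε m) := by
  let w : (Fin d → Z) → unitInterval := fun p =>
    ⟨P.real {z | (p, z) ∉ W}, measureReal_nonneg, measureReal_le_one⟩
  have hw : Measurable w :=
    ((measurable_measure_prodMk_left hW.compl).ennreal_toReal).subtype_mk
  have hwP (p : Fin d → Z) : P {z | (p, z) ∉ W} = ENNReal.ofReal (w p) :=
    (ofReal_measureReal).symm
  have hcard (m : ℕ) : Fintype.card {J : Finset (Fin m) // J.card = d} = m.choose d := by
    rw [Fintype.card_finset_len, Fintype.card_fin]
  -- The moments come from samples of every size `d + k`: the events "`J` is unviolated" are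
  -- equiprobable and almost surely partition the sample space.
  have hlaw : (Measure.pi fun _ : Fin d => P).map w = betaUnit d := by
    have := Measure.isProbabilityMeasure_map (μ := Measure.pi fun _ : Fin d => P) hw.aemeasurable
    refine eq_betaUnit_of_lintegral_pow hd _ fun k => ?_
    rw [lintegral_map (by fun_prop) hw]
    have hJ (J : {J : Finset (Fin (d + k)) // J.card = d}) :
        (Measure.pi fun _ : Fin (d + k) => P) {s | Unviolated W s J}
          = ∫⁻ p, ENNReal.ofReal ((w p : ℝ) ^ k) ∂(Measure.pi fun _ : Fin d => P) := by
      have h := measure_subsample_unviolated P hW MeasurableSet.univ J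
      simp only [Set.mem_univ, true_and, Measure.restrict_univ, Nat.add_sub_cancel_left, hwP] at h
      rw [h]
      exact lintegral_congr fun p => (ENNReal.ofReal_pow (w p).2.1 k).symm
    have hsum : (Measure.pi fun _ : Fin (d + k) => P) (⋃ J, {s | Unviolated W s J})
        = ∑' J : {J : Finset (Fin (d + k)) // J.card = d},
          (Measure.pi fun _ : Fin (d + k) => P) {s | Unviolated W s J} := by
      refine measure_iUnion₀ (fun J J' hne => ?_)
        fun J => (measurableSet_unviolated hW J).nullMeasurableSet
      refine measure_mono_null (t := {s | ¬ ∃! J : {J : Finset (Fin (d + k)) // J.card = d},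
        Unviolated W s J}) (fun s hs hu => hne (hu.unique hs.1 hs.2)) ?_
      exact ae_iff.1 (hex (d + k) (Nat.le_add_right d k))
    have hone : (Measure.pi fun _ : Fin (d + k) => P) (⋃ J, {s | Unviolated W s J}) = 1 := by
      rw [← prob_compl_eq_zero_iff (MeasurableSet.iUnion fun J => measurableSet_unviolated hW J)]
      refine measure_mono_null ?_ (ae_iff.1 (hex (d + k) (Nat.le_add_right d k)))
      intro s hs hu
      exact hs (Set.mem_iUnion.2 hu.exists)
    rw [hone, tsum_fintype] at hsum
    simp only [hJ, Finset.sum_const, Finset.card_univ, hcard, nsmul_eq_mul] at hsum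
    exact ENNReal.eq_inv_of_mul_eq_one_left (by rw [mul_comm]; exact hsum.symm)
  -- `A` consists of the subsamples violated with probability at least `ε`.
  let A : Set (Fin d → Z) := w ⁻¹' {x | (x : ℝ) ≤ 1 - ε}
  have hB : MeasurableSet {x : unitInterval | (x : ℝ) ≤ 1 - ε} :=
    measurableSet_le measurable_subtype_coe measurable_const
  have hA : MeasurableSet A := hw hB
  have hsub : {s : Fin m → Z | ∃ J : {J : Finset (Fin m) // J.card = d},
      Unviolated W s J ∧ ε < P.real {z | (subsample s J, z) ∈ W}}
      ⊆ ⋃ J, {s | subsample s J ∈ A ∧ Unviolated W s J} := by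
    rintro s ⟨J, h1, h2⟩
    refine Set.mem_iUnion.2 ⟨J, ?_, h1⟩
    have hms : MeasurableSet {z | (subsample s J, z) ∈ W} := measurable_prodMk_left hW
    have h3 := probReal_compl_eq_one_sub (μ := P) hms
    change P.real {z | (subsample s J, z) ∈ W}ᶜ ≤ 1 - ε
    rw [h3]; linarith
  have hJ (J : {J : Finset (Fin m) // J.card = d}) :
      (Measure.pi fun _ : Fin m => P) {s | subsample s J ∈ A ∧ Unviolated W s J}
        = ENNReal.ofReal (binomTail d ε m / m.choose d) := by
    obtain ⟨k, rfl⟩ := Nat.exists_eq_add_of_le hm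
    rw [measure_subsample_unviolated P hW hA J, ← setLIntegral_pow_betaUnit d k hε, ← hlaw,
      setLIntegral_map hB (by fun_prop) hw, Nat.add_sub_cancel_left]
    refine lintegral_congr fun p => ?_
    rw [hwP, ENNReal.ofReal_pow (w p).2.1]
  refine (measure_mono hsub).trans ((measure_iUnion_le _).trans ?_)
  rw [tsum_fintype]
  simp only [hJ, Finset.sum_const, Finset.card_univ, hcard, nsmul_eq_mul]
  have hc : (0 : ℝ) < m.choose d := by exact_mod_cast Nat.choose_pos hm
  rw [← ENNReal.ofReal_natCast, ← ENNReal.ofReal_mul hc.le, mul_div_cancel₀ _ hc.ne']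

end Compression

/-! ### Minimizers over convex feasible sets -/

/-- The minimizers of `h` over `K`. -/
def argminOn {E : Type*} (h : E → ℝ) (K : Set E) : Set E := {x | x ∈ K ∧ ∀ y ∈ K, h x ≤ h y}

/-- The points of `X` at which all functions `G t` are at most `γ`. -/
def feasibleSet {E ι : Type*} (X : Set E) (G : ι → E → ℝ) (γ : ℝ) : Set E :=
  {x | x ∈ X ∧ ∀ t, G t x ≤ γ}

theorem MapClusterPt.mem_of_isClosed {E α : Type*} [TopologicalSpace E] {x : E} {F : Filter α}
    {u : α → E} (h : MapClusterPt x F u) {S : Set E} (hS : IsClosed S) (hu : ∀ᶠ a in F, u a ∈ S) :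
    x ∈ S :=
  isClosed_iff_clusterPt.1 hS x (ClusterPt.mono h (Filter.le_principal_iff.2 hu))

theorem LowerSemicontinuousOn.isClosed_sublevel {E : Type*} [TopologicalSpace E] {X : Set E}
    {g : E → ℝ} (hg : LowerSemicontinuousOn g X)
    (hX : IsClosed X) (c : ℝ) : IsClosed {x | x ∈ X ∧ g x ≤ c} := by
  obtain ⟨v, hv, he⟩ := lowerSemicontinuousOn_iff_preimage_Iic.1 hg c
  have : {x | x ∈ X ∧ g x ≤ c} = X ∩ v := he
  rw [this]
  exact hX.inter hv

theorem argminOn_nonempty {E : Type*} [TopologicalSpace E] {K : Set E} (hK : IsCompact K) (hne : K.Nonempty) {h : E → ℝ}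
    (hc : Continuous h) : (argminOn h K).Nonempty := by
  obtain ⟨x, hx, hmin⟩ := hK.exists_isMinOn hne hc.continuousOn
  exact ⟨x, hx, fun y hy => hmin hy⟩

theorem argminOn_mono {E : Type*} {K L : Set E} (hKL : K ⊆ L) {h : E → ℝ} {x : E} (hx : x ∈ argminOn h L)
    (hxK : x ∈ K) : x ∈ argminOn h K :=
  ⟨hxK, fun y hy => hx.2 y (hKL hy)⟩

theorem isCompact_feasibleSet {E ι : Type*} [TopologicalSpace E] [T2Space E] {X : Set E} {G : ι → E → ℝ} {γ : ℝ}
    (hX : IsCompact X) (hG : ∀ t, LowerSemicontinuousOn (G t) X) :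
    IsCompact (feasibleSet X G γ) := by
  have : feasibleSet X G γ = X ∩ ⋂ t, {x | x ∈ X ∧ G t x ≤ γ} := by
    ext x
    simp only [feasibleSet, Set.mem_ofPred_eq, Set.mem_inter_iff, Set.mem_iInter]
    exact ⟨fun h => ⟨h.1, fun t => ⟨h.1, h.2 t⟩⟩, fun h => ⟨h.1, fun t => (h.2 t).2⟩⟩
  rw [this]
  exact hX.inter_right (isClosed_iInter fun t => (hG t).isClosed_sublevel hX.isClosed γ)

section Feasible

variable {E : Type*} [NormedAddCommGroup E] [NormedSpace ℝ E] {X : Set E}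

variable {ι : Type*} {G : ι → E → ℝ} {γ : ℝ}

theorem convex_feasibleSet (hX : Convex ℝ X) (hG : ∀ t, ConvexOn ℝ X (G t)) :
    Convex ℝ (feasibleSet X G γ) := by
  have : feasibleSet X G γ = X ∩ ⋂ t, {x | x ∈ X ∧ G t x ≤ γ} := by
    ext x
    simp only [feasibleSet, Set.mem_ofPred_eq, Set.mem_inter_iff, Set.mem_iInter]
    exact ⟨fun h => ⟨h.1, fun t => ⟨h.1, h.2 t⟩⟩, fun h => ⟨h.1, fun t => (h.2 t).2⟩⟩
  rw [this]
  exact hX.inter (convex_iInter fun t => (hG t).convex_le γ)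

theorem argminOn_eq_of_strictConvexOn {K : Set E} {h : E → ℝ} (hh : StrictConvexOn ℝ K h)
    {x y : E} (hx : x ∈ argminOn h K) (hy : y ∈ argminOn h K) : x = y :=
  hh.eq_of_isMinOn (fun z hz => hx.2 z hz) (fun z hz => hy.2 z hz) hx.1 hy.1

/-- Convex combinations with a small weight keep a strict inequality. -/
theorem ConvexOn.eventually_combo_lt {g : E → ℝ} (hg : ConvexOn ℝ X g) {x y : E} (hx : x ∈ X)
    (hy : y ∈ X) {c : ℝ} (h : g x < c) :
    ∀ᶠ r in nhdsWithin (0 : ℝ) (Set.Ioi 0), g ((1 - r) • x + r • y) < c := by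
  have h1 : ∀ᶠ r in nhds (0 : ℝ), (1 - r) * g x + r * g y < c := by
    have hca : ContinuousAt (fun r : ℝ => (1 - r) * g x + r * g y) 0 := by fun_prop
    exact hca.tendsto.eventually_lt_const (by simpa using h)
  filter_upwards [h1.filter_mono nhdsWithin_le_nhds, Ioo_mem_nhdsGT (show (0 : ℝ) < 1 by norm_num)]
    with r hr hr01
  exact (hg.2 hx hy (by linarith [hr01.2]) hr01.1.le (by ring)).trans_lt hr

/-- Constraints that are inactive at a minimizer may be removed. -/
theorem argminOn_of_inactive [Finite ι] (hX : Convex ℝ X) (hG : ∀ t, ConvexOn ℝ X (G t))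
    {h : E → ℝ}
    (hh : ConvexOn ℝ X h) {x : E} (hx : x ∈ argminOn h (feasibleSet X G γ)) {J : Finset ι}
    (hJ : ∀ t ∉ J, G t x ≠ γ) :
    x ∈ argminOn h (feasibleSet X (fun t : J => G t) γ) := by
  refine ⟨⟨hx.1.1, fun t => hx.1.2 t⟩, fun y hy => ?_⟩
  by_contra! hlt
  -- A short move from `x` towards a supposedly better `y` keeps the slack constraints satisfied,
  -- and convexity handles those in `J`; it would improve the objective.
  have h1 : ∀ᶠ r in nhdsWithin (0 : ℝ) (Set.Ioi 0), ∀ t, t ∉ J →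
      G t ((1 - r) • x + r • y) < γ := by
    rw [Filter.eventually_all]
    intro t
    by_cases ht : t ∈ J
    · simp [ht]
    · have := (hG t).eventually_combo_lt hx.1.1 hy.1 (lt_of_le_of_ne (hx.1.2 t) (hJ t ht))
      exact this.mono fun r hr _ => hr
  obtain ⟨r, hr, hr01⟩ :=
    (h1.and (Ioo_mem_nhdsGT (show (0 : ℝ) < 1 by norm_num))).exists
  have hr0 := hr01.1
  have hr1 : 0 ≤ 1 - r := by linarith [hr01.2]
  have hmem : (1 - r) • x + r • y ∈ feasibleSet X G γ := by
    refine ⟨hX hx.1.1 hy.1 hr1 hr0.le (by ring), fun t => ?_⟩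
    by_cases ht : t ∈ J
    · have h2 := (hG t).2 hx.1.1 hy.1 hr1 hr0.le (by ring)
      have h3 := hx.1.2 t
      have h4 := hy.2 ⟨t, ht⟩
      simp only [smul_eq_mul] at h2 h4
      nlinarith
    · exact (hr t ht).le
  have h5 := hx.2 _ hmem
  have h6 := hh.2 hx.1.1 hy.1 hr1 hr0.le (by ring)
  simp only [smul_eq_mul] at h6
  nlinarith

/-- A minimizer is determined by at most as many constraints as the dimension. -/
theorem exists_finset_argminOn [FiniteDimensional ℝ E] [Finite ι]
    (hG : ∀ t, ConvexOn ℝ X (G t)) {h : E → ℝ}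
    (hh : ConvexOn ℝ X h) {x : E} (hx : x ∈ argminOn h (feasibleSet X G γ)) :
    ∃ J : Finset ι, J.card ≤ Module.finrank ℝ E ∧
      x ∈ argminOn h (feasibleSet X (fun t : J => G t) γ) := by
  classical
  have := Fintype.ofFinite ι
  -- Helly is applied to the constraint sets together with the set `F none` of strictly better
  -- points. A subfamily of at most `dim + 1` sets with empty intersection must contain `F none`,
  -- since `x` lies in all the others; dropping it leaves at most `dim` constraints.
  let F : Option ι → Set E := fun o => o.elim {y | y ∈ X ∧ h y < h x} fun t => {y | y ∈ X ∧ G t y ≤ γ}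
  have hconv : ∀ o ∈ (Finset.univ : Finset (Option ι)), Convex ℝ (F o) := by
    rintro (_ | t) _
    · exact hh.convex_lt _
    · exact (hG t).convex_le _
  have hempty : ¬ (⋂ o ∈ (Finset.univ : Finset (Option ι)), F o).Nonempty := by
    rintro ⟨y, hy⟩
    simp only [Finset.mem_univ, Set.iInter_true, Set.mem_iInter] at hy
    have h0 : y ∈ X ∧ h y < h x := hy none
    have h1 (t : ι) : y ∈ X ∧ G t y ≤ γ := hy (some t)
    exact absurd (hx.2 y ⟨h0.1, fun t => (h1 t).2⟩) (not_le.2 h0.2)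
  have hH := mt (Convex.helly_theorem' (𝕜 := ℝ) hconv) hempty
  push Not at hH
  obtain ⟨I, -, hcard, hI⟩ := hH
  have hnone : none ∈ I := by
    by_contra hn
    refine (Set.nonempty_iff_ne_empty.1 ⟨x, ?_⟩) hI
    simp only [Set.mem_iInter]
    rintro (_ | t) ho
    · exact absurd ho hn
    · exact ⟨hx.1.1, hx.1.2 t⟩
  refine ⟨I.eraseNone, ?_, ⟨hx.1.1, fun t => hx.1.2 t⟩, fun y hy => ?_⟩
  · rw [Finset.card_eraseNone_of_mem hnone]; omega
  · by_contra! hlt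
    refine (Set.nonempty_iff_ne_empty.1 ⟨y, ?_⟩) hI
    simp only [Set.mem_iInter]
    rintro (_ | t) ho
    · exact ⟨hy.1, hlt⟩
    · exact ⟨hy.1, hy.2 ⟨t, Finset.mem_eraseNone.2 ho⟩⟩

/-- Strict convex inequalities that hold at a point of `X` hold at a point of any dense set. -/
theorem exists_dense_strict [FiniteDimensional ℝ E] [Finite ι] (hX : Convex ℝ X)
    (hint : (interior X).Nonempty) (hG : ∀ t, ConvexOn ℝ X (G t)) {h : E → ℝ}
    (hc : Continuous h) {D : Set E} (hD : Dense D) {U : Set E} (hU : IsOpen U) {b : ℝ} {x : E}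
    (hxX : x ∈ X) (hxU : x ∈ U) (hx : ∀ t, G t x < γ) (hxb : h x < b) :
    ∃ q ∈ D, q ∈ interior X ∧ q ∈ U ∧ (∀ t, G t q < γ) ∧ h q < b := by
  -- A short move towards an interior point reaches the interior of `X`, where finite convex
  -- functions are continuous, so a whole neighbourhood satisfies the strict inequalities.
  obtain ⟨y, hy⟩ := hint
  have hyX := interior_subset hy
  have hlim : Filter.Tendsto (fun r : ℝ => (1 - r) • x + r • y) (nhdsWithin (0 : ℝ) (Set.Ioi 0))
      (nhds x) := by
    have : ContinuousAt (fun r : ℝ => (1 - r) • x + r • y) 0 := by fun_prop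
    have h2 : Filter.Tendsto (fun r : ℝ => (1 - r) • x + r • y) (nhds 0)
      (nhds ((1 - (0 : ℝ)) • x + (0 : ℝ) • y)) := this
    simp only [sub_zero, one_smul, zero_smul, add_zero] at h2
    exact h2.mono_left nhdsWithin_le_nhds
  have h1 : ∀ᶠ r in nhdsWithin (0 : ℝ) (Set.Ioi 0), ∀ t, G t ((1 - r) • x + r • y) < γ :=
    Filter.eventually_all.2 fun t => (hG t).eventually_combo_lt hxX hyX (hx t)
  have h2 := hlim.eventually (hU.mem_nhds hxU)
  have h3 := hlim.eventually ((hc.tendsto x).eventually_lt_const hxb)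
  obtain ⟨r, ⟨⟨hr1, hr2⟩, hr3⟩, hr4⟩ := (((h1.and h2).and h3).and
    (Ioo_mem_nhdsGT (show (0 : ℝ) < 1 by norm_num))).exists
  set z := (1 - r) • x + r • y
  have hz : z ∈ interior X :=
    hX.combo_self_interior_mem_interior hxX hy (by linarith [hr4.2]) hr4.1 (by ring)
  have hnhds : ∀ᶠ q in nhds z, q ∈ interior X ∧ q ∈ U ∧ (∀ t, G t q < γ) ∧ h q < b := by
    refine Filter.Eventually.and (isOpen_interior.mem_nhds hz)
      (Filter.Eventually.and (hU.mem_nhds hr2) (Filter.Eventually.and ?_ ?_))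
    · refine Filter.eventually_all.2 fun t => ?_
      have := (hG t).continuousOn_interior.continuousAt (isOpen_interior.mem_nhds hz)
      exact this.tendsto.eventually_lt_const (hr1 t)
    · exact (hc.tendsto z).eventually_lt_const hr3
  obtain ⟨V, hV, hVo, hzV⟩ := eventually_nhds_iff.1 hnhds
  obtain ⟨q, hqV, hqD⟩ := hD.inter_open_nonempty V hVo ⟨z, hzV⟩
  exact ⟨q, hqD, hV q hqV⟩

/-- For countable `D` this turns feasibility into countably many conditions on single values of the
constraints, which yields measurability. Conversely, a cluster point of the approximate solutions is
feasible by compactness and lower semicontinuity. -/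
theorem exists_feasible_iff_dense [FiniteDimensional ℝ E] [Finite ι] (hXc : IsCompact X)
    (hX : Convex ℝ X) (hint : (interior X).Nonempty) (hG : ∀ t, ConvexOn ℝ X (G t))
    (hlsc : ∀ t, LowerSemicontinuousOn (G t) X) {h : E → ℝ} (hc : Continuous h) {D : Set E}
    (hD : Dense D) {C : Set E} (hC : IsClosed C) (b : ℝ) :
    (∃ x ∈ feasibleSet X G γ, x ∈ C ∧ h x ≤ b) ↔
      ∀ n : ℕ, ∃ q ∈ D, q ∈ interior X ∧ q ∈ Metric.thickening (1 / ((n : ℝ) + 1)) C ∧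
        (∀ t, G t q < γ + 1 / ((n : ℝ) + 1)) ∧ h q < b + 1 / ((n : ℝ) + 1) := by
  constructor
  · rintro ⟨x, hx, hxC, hxb⟩ n
    have hn : (0 : ℝ) < 1 / ((n : ℝ) + 1) := Nat.one_div_pos_of_nat
    exact exists_dense_strict hX hint hG hc hD Metric.isOpen_thickening hx.1
      (Metric.self_subset_thickening hn C hxC) (fun t => by linarith [hx.2 t]) (by linarith)
  · intro H
    choose q hqD hqX hqC hqG hqb using H
    obtain ⟨x, hxX, hx⟩ := hXc.exists_mapClusterPt (f := Filter.atTop) (u := q)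
      (Filter.le_principal_iff.2 (Filter.mem_map.2
        (Filter.Eventually.of_forall fun n => interior_subset (hqX n))))
    have hsmall {r : ℝ} (hr : 0 < r) : ∀ᶠ n : ℕ in Filter.atTop, 1 / ((n : ℝ) + 1) < r :=
      tendsto_one_div_add_atTop_nhds_zero_nat.eventually_lt_const hr
    refine ⟨x, ⟨hxX, fun t => ?_⟩, ?_, ?_⟩
    · refine le_of_forall_pos_le_add fun r hr => ?_
      refine (hx.mem_of_isClosed ((hlsc t).isClosed_sublevel hXc.isClosed (γ + r)) ?_).2
      filter_upwards [hsmall hr] with n hn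
      exact ⟨interior_subset (hqX n), by linarith [hqG n t]⟩
    · rw [← hC.closure_eq, Metric.closure_eq_iInter_cthickening]
      simp only [Set.mem_iInter]
      intro r hr
      refine hx.mem_of_isClosed Metric.isClosed_cthickening ?_
      filter_upwards [hsmall hr] with n hn
      exact Metric.cthickening_mono hn.le _ (Metric.thickening_subset_cthickening _ _ (hqC n))
    · refine le_of_forall_pos_le_add fun r hr => ?_
      refine hx.mem_of_isClosed (isClosed_le hc continuous_const) ?_
      filter_upwards [hsmall hr] with n hn
      exact le_of_lt (by linarith [hqb n])

end Feasible

/-! ### Measurable choice of minimizers -/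

theorem measurable_section {E Z : Type*} [MeasurableSpace E] [MeasurableSpace Z]
    {X : Set E} {f : E → Z → ℝ}
    (hmeas : Measurable fun p : X × Z => f (p.1 : E) p.2) {x : E} (hx : x ∈ X) :
    Measurable (f x) :=
  hmeas.comp (measurable_prodMk_left (x := (⟨x, hx⟩ : X)))

section Random

variable {E : Type*} [NormedAddCommGroup E] [NormedSpace ℝ E] [FiniteDimensional ℝ E]
  [MeasurableSpace E] [BorelSpace E] {X : Set E} {Z : Type*} [MeasurableSpace Z]

theorem exists_measurable_argminOn (hXc : IsCompact X) (hX : Convex ℝ X)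
    (hint : (interior X).Nonempty) {f : E → Z → ℝ} {γ : ℝ}
    (hmeas : Measurable fun p : X × Z => f (p.1 : E) p.2)
    (hconv : ∀ z, ConvexOn ℝ X fun x => f x z)
    (hlsc : ∀ z, LowerSemicontinuousOn (fun x => f x z) X)
    (hfeas : ∃ x ∈ X, ∀ z, f x z ≤ γ) {h : E → ℝ} (hc : Continuous h)
    (hh : StrictConvexOn ℝ X h) (m : ℕ) :
    ∃ σ : (Fin m → Z) → X, Measurable σ ∧
      ∀ s, (σ s : E) ∈ argminOn h (feasibleSet X (fun t x => f x (s t)) γ) := by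
  obtain ⟨x₀, hx₀, hx₀f⟩ := hfeas
  have hex (s : Fin m → Z) : ∃ x : X,
      (x : E) ∈ argminOn h (feasibleSet X (fun t x => f x (s t)) γ) := by
    obtain ⟨x, hx⟩ := argminOn_nonempty
      (isCompact_feasibleSet (γ := γ) hXc fun t => hlsc (s t)) ⟨x₀, hx₀, fun t => hx₀f _⟩ hc
    exact ⟨⟨x, hx.1.1⟩, hx⟩
  choose σ hσ using hex
  refine ⟨σ, ?_, hσ⟩
  obtain ⟨D, hDc, hD⟩ := TopologicalSpace.exists_countable_dense E
  have hiff (s : Fin m → Z) {C : Set E} (hC : IsClosed C) (b : ℝ) :=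
    exists_feasible_iff_dense (γ := γ) hXc hX hint (fun t => hconv (s t)) (fun t => hlsc (s t))
      hc hD hC b
  have hset (C : Set E) (b : (Fin m → Z) → ℝ) (hb : Measurable b) :
      MeasurableSet {s : Fin m → Z | ∀ n : ℕ, ∃ q ∈ D, q ∈ interior X ∧
        q ∈ Metric.thickening (1 / ((n : ℝ) + 1)) C ∧
        (∀ t, f q (s t) < γ + 1 / ((n : ℝ) + 1)) ∧ h q < b s + 1 / ((n : ℝ) + 1)} := by
    simp only [Set.ofPred_forall, Set.ofPred_exists]
    refine MeasurableSet.iInter fun n => ?_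
    have : (⋃ q, {s : Fin m → Z | q ∈ D ∧ q ∈ interior X ∧
        q ∈ Metric.thickening (1 / ((n : ℝ) + 1)) C ∧
        (∀ t, f q (s t) < γ + 1 / ((n : ℝ) + 1)) ∧ h q < b s + 1 / ((n : ℝ) + 1)})
      = ⋃ q ∈ D, {s : Fin m → Z | q ∈ interior X ∧
        q ∈ Metric.thickening (1 / ((n : ℝ) + 1)) C ∧
        (∀ t, f q (s t) < γ + 1 / ((n : ℝ) + 1)) ∧ h q < b s + 1 / ((n : ℝ) + 1)} := by
      ext s; simp only [Set.mem_iUnion, Set.mem_ofPred_eq, exists_prop]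
    rw [this]
    refine MeasurableSet.biUnion hDc fun q _ => ?_
    by_cases hq : q ∈ interior X
    · refine (MeasurableSet.const _).inter ((MeasurableSet.const _).inter
        (MeasurableSet.inter (s₁ := {s : Fin m → Z | ∀ t, f q (s t) < γ + 1 / ((n : ℝ) + 1)}) ?_
          (measurableSet_lt measurable_const (hb.add_const _))))
      simp only [Set.ofPred_forall]
      refine MeasurableSet.iInter fun t => measurableSet_lt ?_ measurable_const
      exact (measurable_section hmeas (interior_subset hq)).comp (measurable_pi_apply t)
    · simp [hq]
  -- The optimal value comes first, because `σ s ∈ C` means that some feasible point of `C` has cost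
  -- at most `h (σ s)`.
  have hJ : Measurable fun s => h (σ s) := by
    refine measurable_of_Iic fun b => ?_
    convert hset Set.univ (fun _ => b) measurable_const using 1
    ext s
    refine Iff.trans ?_ (hiff s isClosed_univ b)
    exact ⟨fun hs => ⟨σ s, (hσ s).1, trivial, hs⟩,
      fun ⟨x, hx, _, hxb⟩ => ((hσ s).2 x hx).trans hxb⟩
  refine Measurable.subtype_mk (f := fun s => (σ s : E)) ?_
  refine measurable_of_isClosed fun C hC => ?_
  convert hset C (fun s => h (σ s)) hJ using 1
  ext s
  refine Iff.trans ?_ (hiff s hC (h (σ s)))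
  refine ⟨fun hs => ⟨σ s, (hσ s).1, hs, le_rfl⟩, fun ⟨x, hx, hxC, hxb⟩ => ?_⟩
  have hxmin : x ∈ argminOn h (feasibleSet X (fun t x => f x (s t)) γ) :=
    ⟨hx, fun y hy => hxb.trans ((hσ s).2 y hy)⟩
  have := argminOn_eq_of_strictConvexOn (hh.subset (fun y hy => hy.1)
    (convex_feasibleSet hX fun t => hconv (s t))) (hσ s) hxmin
  rw [Set.mem_preimage, this]
  exact hxC

end Random

/-! ### Nondegenerate random programs -/

/-- Greedy: add the remaining index with the smallest label, one at a time. This canonically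
completes the set of tight constraints to `d` elements. -/
theorem exists_superset_card_eq_smallest {m d : ℕ} (ℓ : Fin m → ℝ) {B : Finset (Fin m)}
    (hB : B.card ≤ d) (hd : d ≤ m) :
    ∃ J : Finset (Fin m), B ⊆ J ∧ J.card = d ∧ ∀ t ∉ J, ∀ i ∈ J, i ∉ B → ℓ i ≤ ℓ t := by
  induction d, hB using Nat.le_induction with
  | base => exact ⟨B, subset_rfl, rfl, fun t _ i hi hi' => absurd hi hi'⟩
  | succ d hB ih =>
    obtain ⟨J, hBJ, hJ, hmin⟩ := ih (by omega)
    have hne : (Jᶜ).Nonempty := by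
      rw [← Finset.card_pos, Finset.card_compl, Fintype.card_fin]; omega
    obtain ⟨t₀, ht₀, ht₀min⟩ := Finset.exists_min_image Jᶜ ℓ hne
    rw [Finset.mem_compl] at ht₀
    refine ⟨insert t₀ J, hBJ.trans (Finset.subset_insert _ _), ?_, fun t ht i hi hiB => ?_⟩
    · rw [Finset.card_insert_of_notMem ht₀, hJ]
    · have htJ : t ∉ J := fun h => ht (Finset.mem_insert_of_mem h)
      rcases Finset.mem_insert.1 hi with rfl | hi
      · exact ht₀min t (Finset.mem_compl.2 htJ)
      · exact hmin t htJ i hi hiB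

theorem forall_subsample_iff {Z : Type*} {m d : ℕ} (s : Fin m → Z)
    (J : {J : Finset (Fin m) // J.card = d}) (p : Z → Prop) :
    (∀ i, p (subsample s J i)) ↔ ∀ t ∈ J.1, p (s t) := by
  refine ⟨fun h t ht => ?_, fun h i => h _ (Finset.orderEmbOfFin_mem _ _ _)⟩
  have : t ∈ Set.range (J.1.orderEmbOfFin J.2) := by rw [Finset.range_orderEmbOfFin]; exact ht
  obtain ⟨i, rfl⟩ := this
  exact h i

/-- An event that is almost surely avoided by every new observation is almost surely avoided by
all observations outside a subsample. -/
theorem ae_unviolated {Z : Type*} [MeasurableSpace Z] (P : Measure Z) [IsProbabilityMeasure P]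
    {d m : ℕ} {W : Set ((Fin d → Z) × Z)} (hW : MeasurableSet W)
    (h : ∀ p, P {z | (p, z) ∈ W} = 0) :
    ∀ᵐ s ∂(Measure.pi fun _ : Fin m => P),
      ∀ J : {J : Finset (Fin m) // J.card = d}, Unviolated W s J := by
  refine ae_all_iff.2 fun J => ?_
  have h1 := measure_subsample_unviolated P hW MeasurableSet.univ J
  have h2 (p : Fin d → Z) : P {z | (p, z) ∉ W} = 1 :=
    (prob_compl_eq_one_iff (measurable_prodMk_left hW)).2 (h p)
  simp only [Set.mem_univ, true_and, h2, one_pow, lintegral_one, Measure.restrict_univ,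
    measure_univ] at h1
  exact (prob_compl_eq_zero_iff (measurableSet_unviolated hW J)).2 h1

theorem ae_injective_label {Z : Type*} [MeasurableSpace Z] (P : Measure Z)
    [IsProbabilityMeasure P] {ℓ : Z → ℝ} (hℓ : Measurable ℓ) (h : ∀ c, P {z | ℓ z = c} = 0)
    (m : ℕ) :
    ∀ᵐ s ∂(Measure.pi fun _ : Fin m => P), ∀ t t', t ≠ t' → ℓ (s t) ≠ ℓ (s t') := by
  have hW : MeasurableSet {q : (Fin 1 → Z) × Z | ℓ q.2 = ℓ (q.1 0)} :=
    measurableSet_eq_fun (by fun_prop) (by fun_prop)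
  filter_upwards [ae_unviolated P (m := m) hW fun p => h (ℓ (p 0))] with s hs t t' hne heq
  have h1 := hs ⟨{t'}, Finset.card_singleton t'⟩ t (by simpa using hne)
  refine h1 (heq.trans ?_)
  simp [subsample]

theorem measure_violation_le_of_nondegenerate {E : Type*} [NormedAddCommGroup E]
    [NormedSpace ℝ E] [FiniteDimensional ℝ E] [MeasurableSpace E] [BorelSpace E] {X : Set E}
    {Z : Type*} [MeasurableSpace Z] (P : Measure Z) [IsProbabilityMeasure P]
    (hXc : IsCompact X) (hX : Convex ℝ X)
    (hint : (interior X).Nonempty) {f : E → Z → ℝ} {γ : ℝ}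
    (hmeas : Measurable fun p : X × Z => f (p.1 : E) p.2)
    (hconv : ∀ z, ConvexOn ℝ X fun x => f x z)
    (hlsc : ∀ z, LowerSemicontinuousOn (fun x => f x z) X)
    (hfeas : ∃ x ∈ X, ∀ z, f x z ≤ γ) {h : E → ℝ} (hc : Continuous h)
    (hh : StrictConvexOn ℝ X h) {ℓ : Z → ℝ} (hℓ : Measurable ℓ) (hℓ0 : ∀ c, P {z | ℓ z = c} = 0)
    (hnd : ∀ x ∈ X, P {z | f x z = γ} = 0) (hd : 0 < Module.finrank ℝ E) {m : ℕ}
    (hm : Module.finrank ℝ E ≤ m) {ε : ℝ} (hε : ε ∈ Set.Icc (0 : ℝ) 1) :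
    (Measure.pi fun _ : Fin m => P)
      {s | ∃ x ∈ argminOn h (feasibleSet X (fun t x => f x (s t)) γ),
        ε < P.real {z | γ < f x z}} ≤ ENNReal.ofReal (binomTail (Module.finrank ℝ E) ε m) := by
  set d := Module.finrank ℝ E
  obtain ⟨σ, hσm, hσ⟩ := exists_measurable_argminOn hXc hX hint hmeas hconv hlsc hfeas hc hh d
  have hval : Measurable fun q : (Fin d → Z) × Z => f (σ q.1) q.2 :=
    hmeas.comp ((hσm.comp measurable_fst).prodMk measurable_snd)
  have hvali (i : Fin d) : Measurable fun q : (Fin d → Z) × Z => f (σ q.1) (q.1 i) :=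
    hmeas.comp ((hσm.comp measurable_fst).prodMk (by fun_prop))
  -- The second alternative only breaks ties among subsets with the same solution: a slack member of
  -- the subsample must not be replaceable by an observation with a smaller label.
  let W : Set ((Fin d → Z) × Z) := {q | γ < f (σ q.1) q.2 ∨
    ∃ i, f (σ q.1) (q.1 i) ≠ γ ∧ ℓ q.2 < ℓ (q.1 i)}
  have hW : MeasurableSet W := by
    refine (measurableSet_lt measurable_const hval).union ?_
    change MeasurableSet {q : (Fin d → Z) × Z | ∃ i, f (σ q.1) (q.1 i) ≠ γ ∧ ℓ q.2 < ℓ (q.1 i)}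
    simp only [Set.ofPred_exists]
    refine MeasurableSet.iUnion fun i => ?_
    exact (measurableSet_eq_fun (hvali i) measurable_const).compl.inter
      (measurableSet_lt (hℓ.comp measurable_snd)
        (hℓ.comp ((measurable_pi_apply i).comp measurable_fst)))
  have hN : MeasurableSet {q : (Fin d → Z) × Z | f (σ q.1) q.2 = γ} :=
    measurableSet_eq_fun hval measurable_const
  have key (n : ℕ) (hn : d ≤ n) : ∀ᵐ s ∂(Measure.pi fun _ : Fin n => P),
      (∃! J : {J : Finset (Fin n) // J.card = d}, Unviolated W s J) ∧
      ∀ J : {J : Finset (Fin n) // J.card = d}, Unviolated W s J →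
        ∀ x ∈ argminOn h (feasibleSet X (fun t x => f x (s t)) γ),
          (σ (subsample s J) : E) = x := by
    filter_upwards [ae_unviolated P (m := n) hN fun p => hnd (σ p) (σ p).2,
      ae_injective_label P hℓ hℓ0 n] with s hs hinj
    have hsub (J : {J : Finset (Fin n) // J.card = d}) :
        feasibleSet X (fun i x => f x (subsample s J i)) γ
          = feasibleSet X (fun (t : J.1) x => f x (s t)) γ := by
      ext x
      refine and_congr_right fun _ => (forall_subsample_iff s J fun z => f x z ≤ γ).trans ?_
      exact ⟨fun H t => H t t.2, fun H t ht => H ⟨t, ht⟩⟩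
    have huniq {ι : Type} (G : ι → E → ℝ) (hG : ∀ t, ConvexOn ℝ X (G t)) {x y : E}
        (hx : x ∈ argminOn h (feasibleSet X G γ)) (hy : y ∈ argminOn h (feasibleSet X G γ)) :
        x = y :=
      argminOn_eq_of_strictConvexOn (hh.subset (fun y hy => hy.1) (convex_feasibleSet hX hG)) hx hy
    have heq (J : {J : Finset (Fin n) // J.card = d}) {x : E}
        (hx : x ∈ argminOn h (feasibleSet X (fun (t : J.1) x => f x (s t)) γ)) :
        (σ (subsample s J) : E) = x := by
      rw [← hsub] at hx
      exact huniq _ (fun t => hconv _) (hσ _) hx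
    have hle (J : Finset (Fin n)) : feasibleSet X (fun t x => f x (s t)) γ
        ⊆ feasibleSet X (fun (t : J) x => f x (s t)) γ :=
      fun x hx => ⟨hx.1, fun t => hx.2 t⟩
    have hsol (J : {J : Finset (Fin n) // J.card = d}) (hJ : Unviolated W s J) {x : E}
        (hx : x ∈ argminOn h (feasibleSet X (fun t x => f x (s t)) γ)) :
        (σ (subsample s J) : E) = x := by
      have h1 := hσ (subsample s J)
      rw [hsub] at h1
      refine huniq _ (fun t => hconv _) (argminOn_mono (hle J.1) h1 ⟨h1.1.1, fun t => ?_⟩) hx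
      by_cases ht : t ∈ J.1
      · exact h1.1.2 ⟨t, ht⟩
      · exact not_lt.1 fun hlt => hJ t ht (Or.inl hlt)
    obtain ⟨x₀, hx₀, hx₀f⟩ := hfeas
    obtain ⟨x, hx⟩ := argminOn_nonempty (isCompact_feasibleSet (γ := γ) hXc fun t => hlsc (s t))
      ⟨x₀, hx₀, fun t => hx₀f _⟩ hc
    -- An observation outside `J` is independent of the solution for `J`, hence almost surely not
    -- tight there. So every `J` with solution `x` contains all constraints tight at `x`.
    have hactive (J : {J : Finset (Fin n) // J.card = d}) (hJ : (σ (subsample s J) : E) = x)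
        {t : Fin n} (ht : f x (s t) = γ) : t ∈ J.1 := by
      by_contra hn
      refine hs J t hn ?_
      change f (σ (subsample s J)) (s t) = γ
      rw [hJ]; exact ht
    refine ⟨existsUnique_of_exists_of_unique ?_ ?_, fun J hJ y hy => hsol J hJ hy⟩
    · classical
      -- Helly serves only to show that at most `d` constraints are tight; `J` is then built from
      -- the tight set `B`, which determines `x` by itself.
      obtain ⟨I, hI, hIx⟩ := exists_finset_argminOn (fun t => hconv (s t)) hh.convexOn hx
      obtain ⟨I', hII', -, hI'⟩ := Finset.exists_subsuperset_card_eq (Finset.subset_univ I) hI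
        (by simpa using hn)
      have hI'x : (σ (subsample s ⟨I', hI'⟩) : E) = x := by
        refine heq ⟨I', hI'⟩ (argminOn_mono (fun y hy => ?_) hIx (hle I' hx.1))
        exact ⟨hy.1, fun t => hy.2 ⟨t, hII' t.2⟩⟩
      let B : Finset (Fin n) := Finset.univ.filter fun t => f x (s t) = γ
      have hBI : B ⊆ I' := fun t ht => hactive ⟨I', hI'⟩ hI'x (Finset.mem_filter.1 ht).2
      obtain ⟨J, hBJ, hJ, hmin⟩ := exists_superset_card_eq_smallest (fun t => ℓ (s t))
        ((Finset.card_le_card hBI).trans hI'.le) hn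
      have hJx : (σ (subsample s ⟨J, hJ⟩) : E) = x := by
        refine heq ⟨J, hJ⟩ (argminOn_of_inactive hX (fun t => hconv (s t)) hh.convexOn hx ?_)
        intro t ht hta
        exact ht (hBJ (by simpa [B] using hta))
      refine ⟨⟨J, hJ⟩, fun t ht hv => ?_⟩
      rcases hv with hv | ⟨i, hi, hlt⟩
      · simp only [hJx] at hv
        exact absurd (hx.1.2 t) (not_le.2 hv)
      · simp only [hJx] at hi
        refine absurd hlt (not_lt.2 (hmin t ht _ (Finset.orderEmbOfFin_mem J hJ i) ?_))
        simpa [B, subsample] using hi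
    -- Two unviolated subsets both contain the tight constraints, so any `t` in `J` but not `J'` and
    -- `t'` in `J'` but not `J` are slack. Each label is then at most the other, contradicting
    -- distinctness.
    · intro J J' hJ hJ'
      by_contra hne
      have hJJ : ¬ J.1 ⊆ J'.1 := fun hsub' =>
        hne (Subtype.ext (Finset.eq_of_subset_of_card_le hsub' (by rw [J.2, J'.2])))
      have hJJ' : ¬ J'.1 ⊆ J.1 := fun hsub' =>
        hne (Subtype.ext (Finset.eq_of_subset_of_card_le hsub' (by rw [J.2, J'.2])).symm)
      obtain ⟨t, ht, ht'⟩ := Finset.not_subset.1 hJJ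
      obtain ⟨t', htt, htt'⟩ := Finset.not_subset.1 hJJ'
      have hout (J J' : {J : Finset (Fin n) // J.card = d}) (hJ : Unviolated W s J)
          (hJ' : Unviolated W s J') (t t' : Fin n) (ht : t ∈ J.1) (ht' : t ∉ J'.1)
          (htt' : t' ∉ J.1) : ℓ (s t) ≤ ℓ (s t') := by
        by_contra! hlt
        have hti : t ∈ Set.range (J.1.orderEmbOfFin J.2) := by
          rw [Finset.range_orderEmbOfFin]; exact ht
        obtain ⟨i, rfl⟩ := hti
        refine hJ t' htt' (Or.inr ⟨i, fun hact => ht' ?_, hlt⟩)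
        refine hactive J' (hsol J' hJ' hx) ?_
        simp only [hsol J hJ hx] at hact
        exact hact
      have hne' : t ≠ t' := fun h => ht' (h ▸ htt)
      exact hinj t t' hne' (le_antisymm (hout J J' hJ hJ' t t' ht ht' htt')
        (hout J' J hJ' hJ t' t htt htt' ht'))
  refine le_trans ?_ (measure_exists_unviolated_le P hd hW
    (fun n hn => (key n hn).mono fun s hs => hs.1) hm hε)
  refine measure_mono_ae ?_
  filter_upwards [key m hm] with s hs hx
  obtain ⟨x, hx, hxε⟩ := hx
  obtain ⟨J, hJ⟩ := hs.1.exists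
  refine ⟨J, hJ, hxε.trans_le (measureReal_mono fun z hz => Or.inl ?_)⟩
  rw [hs.2 J hJ x hx]
  exact hz

/-! ### Passing to the limit -/

/-- Outer measures are lower semicontinuous along pointwise limits inferior of sets. -/
theorem MeasureTheory.eventually_lt_measure {α : Type*} [MeasurableSpace α] {μ : Measure α}
    {A : Set α} {B : ℕ → Set α} {c : ENNReal} (hc : c < μ A)
    (h : ∀ a ∈ A, ∀ᶠ n in Filter.atTop, a ∈ B n) : ∀ᶠ n in Filter.atTop, c < μ (B n) := by
  let T : ℕ → Set α := fun N => {a | ∀ n ≥ N, a ∈ B n}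
  have hT : Monotone T := fun N N' hN a ha n hn => ha n (hN.trans hn)
  have hA : A ⊆ ⋃ N, T N := fun a ha => by
    obtain ⟨N, hN⟩ := Filter.eventually_atTop.1 (h a ha)
    exact Set.mem_iUnion.2 ⟨N, hN⟩
  have h1 : c < ⨆ N, μ (T N) := by
    rw [← hT.measure_iUnion]
    exact hc.trans_le (measure_mono hA)
  obtain ⟨N, hN⟩ := lt_iSup_iff.1 h1
  filter_upwards [Filter.eventually_ge_atTop N] with n hn
  exact hN.trans_le (measure_mono fun a ha => ha n hn)

/-- Lower semicontinuity of the measure is used twice, for the violation probability of a solution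
and for the probability of a bad sample. Continuity from below holds for outer measures, so no
measurability is needed. -/
theorem measure_violation_le_of_limit {S Z E : Type*} [MeasurableSpace S] [MeasurableSpace Z]
    {μ : Measure S} {P : Measure Z} [IsProbabilityMeasure P] {sol : S → Set E}
    {sols : ℕ → S → Set E} {viol : E → Set Z} {viols : ℕ → E → Set Z} {ε : ℝ} (hε : 0 ≤ ε)
    {c : ENNReal}
    (hlim : ∀ s, ∀ x ∈ sol s, ∃ u : ℕ → E, (∀ n, u n ∈ sols n s) ∧
      ∀ z ∈ viol x, ∀ᶠ n in Filter.atTop, z ∈ viols n (u n))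
    (hbound : ∀ n, μ {s | ∃ x ∈ sols n s, ε < P.real (viols n x)} ≤ c) :
    μ {s | ∃ x ∈ sol s, ε < P.real (viol x)} ≤ c := by
  by_contra! hlt
  have h := eventually_lt_measure (B := fun n => {s | ∃ x ∈ sols n s, ε < P.real (viols n x)}) hlt
    (fun s ⟨x, hx, hxε⟩ => by
      obtain ⟨u, hu, hv⟩ := hlim s x hx
      have h1 : ENNReal.ofReal ε < P (viol x) :=
        (ENNReal.ofReal_lt_iff_lt_toReal hε (measure_ne_top _ _)).2 hxε
      filter_upwards [eventually_lt_measure h1 hv] with n hn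
      exact ⟨u n, hu n, (ENNReal.ofReal_lt_iff_lt_toReal hε (measure_ne_top _ _)).1 hn⟩)
  obtain ⟨n, hn⟩ := h.exists
  exact absurd (hbound n) (not_le.2 hn)

/-- Adding a small multiple of a secondary objective approximates lexicographic minimization. -/
theorem tendsto_argminOn_add_mul {E : Type*} [TopologicalSpace E] [T2Space E] {K : Set E} (hK : IsCompact K) {a g : E → ℝ}
    (ha : Continuous a) (hg : Continuous g) {x : E} (hx : x ∈ argminOn g (argminOn a K))
    (huniq : ∀ y ∈ argminOn g (argminOn a K), y = x) {η : ℕ → ℝ} (hη0 : ∀ n, 0 < η n)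
    (hη : Filter.Tendsto η Filter.atTop (nhds 0)) {u : ℕ → E}
    (hu : ∀ n, u n ∈ argminOn (fun y => a y + η n * g y) K) :
    Filter.Tendsto u Filter.atTop (nhds x) := by
  refine hK.tendsto_nhds_of_unique_mapClusterPt (.of_forall fun n => (hu n).1) ?_
  intro y hyK hy
  -- Since `a x ≤ a (u n)`, this comparison gives `g (u n) ≤ g x`. As `g` is bounded below on `K`,
  -- it also gives `a (u n) ≤ a x + o(1)`.
  have hmin (n : ℕ) : a (u n) + η n * g (u n) ≤ a x + η n * g x := (hu n).2 x hx.1.1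
  have hyg : g y ≤ g x := by
    refine hy.mem_of_isClosed (S := {y | g y ≤ g x}) (isClosed_le hg continuous_const)
      (.of_forall fun n => ?_)
    have h1 := hx.1.2 (u n) (hu n).1
    have h2 := hmin n
    exact le_of_mul_le_mul_left (by linarith) (hη0 n)
  obtain ⟨b, hb, hbmin⟩ := hK.exists_isMinOn ⟨x, hx.1.1⟩ hg.continuousOn
  have hya : a y ≤ a x := by
    refine le_of_forall_pos_le_add fun δ hδ => ?_
    refine hy.mem_of_isClosed (S := {y | a y ≤ a x + δ}) (isClosed_le ha continuous_const) ?_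
    have h0 : Filter.Tendsto (fun n => η n * (g x - g b)) Filter.atTop (nhds 0) := by
      simpa using hη.mul_const (g x - g b)
    filter_upwards [h0.eventually_lt_const hδ] with n hn
    have h1 : g b ≤ g (u n) := hbmin (hu n).1
    have h2 := hmin n
    have h3 := mul_le_mul_of_nonneg_left h1 (hη0 n).le
    show a (u n) ≤ a x + δ
    linarith
  exact huniq y ⟨⟨hyK, fun z hz => hya.trans (hx.1.2 z hz)⟩, fun z hz => hyg.trans (hx.2 z hz)⟩

section Tendsto

variable {E : Type*} [NormedAddCommGroup E] [NormedSpace ℝ E] {X : Set E}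

/-- The minimizers of slightly relaxed programs converge to the minimizer. -/
theorem tendsto_argminOn_relaxed (hXc : IsCompact X) (hX : Convex ℝ X) {ι : Type*}
    {G : ι → E → ℝ} {γ : ℝ} (hG : ∀ t, ConvexOn ℝ X (G t))
    (hlsc : ∀ t, LowerSemicontinuousOn (G t) X) {h : E → ℝ} (hc : Continuous h)
    (hh : StrictConvexOn ℝ X h) {r : ℕ → ι → ℝ} (hr0 : ∀ n t, 0 ≤ r n t)
    (hr : ∀ t, Filter.Tendsto (fun n => r n t) Filter.atTop (nhds 0)) {x : E}
    (hx : x ∈ argminOn h (feasibleSet X G γ)) {u : ℕ → E}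
    (hu : ∀ n, u n ∈ argminOn h (feasibleSet X (fun t y => G t y + -r n t) γ)) :
    Filter.Tendsto u Filter.atTop (nhds x) := by
  refine hXc.tendsto_nhds_of_unique_mapClusterPt (.of_forall fun n => (hu n).1.1) ?_
  intro y hyX hy
  have hyh : h y ≤ h x := by
    refine hy.mem_of_isClosed (S := {y | h y ≤ h x}) (isClosed_le hc continuous_const)
      (.of_forall fun n => (hu n).2 x ⟨hx.1.1, fun t => ?_⟩)
    linarith [hx.1.2 t, hr0 n t]
  have hyG (t : ι) : G t y ≤ γ := by
    refine le_of_forall_pos_le_add fun δ hδ => ?_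
    refine (hy.mem_of_isClosed ((hlsc t).isClosed_sublevel hXc.isClosed (γ + δ)) ?_).2
    filter_upwards [(hr t).eventually_lt_const hδ] with n hn
    exact ⟨(hu n).1.1, by linarith [(hu n).1.2 t]⟩
  exact argminOn_eq_of_strictConvexOn (hh.subset (fun y hy => hy.1) (convex_feasibleSet hX hG))
    ⟨⟨hyX, hyG⟩, fun z hz => hyh.trans (hx.2 z hz)⟩ hx

end Tendsto

/-! ### Lexicographic minimization -/

/-- The points of `K` that minimize a list of objectives lexicographically. -/
def lexArgmin {E : Type*} : List (E → ℝ) → Set E → Set E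
  | [], K => K
  | g :: l, K => lexArgmin l (argminOn g K)

theorem lexArgmin_append {E : Type*} (l l' : List (E → ℝ)) (K : Set E) :
    lexArgmin (l ++ l') K = lexArgmin l' (lexArgmin l K) := by
  induction l generalizing K with
  | nil => rfl
  | cons g l ih => exact ih _

theorem lexArgmin_subset {E : Type*} (l : List (E → ℝ)) (K : Set E) : lexArgmin l K ⊆ K := by
  induction l generalizing K with
  | nil => exact subset_rfl
  | cons g l ih => exact (ih _).trans fun x hx => hx.1

theorem isCompact_argminOn {E : Type*} [TopologicalSpace E] {K : Set E} (hK : IsCompact K)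
    {g : E → ℝ} (hg : Continuous g) : IsCompact (argminOn g K) := by
  have : argminOn g K = K ∩ ⋂ y ∈ K, {x | g x ≤ g y} := by
    ext x; simp [argminOn]
  rw [this]
  exact hK.inter_right (isClosed_biInter fun y _ => isClosed_le hg continuous_const)

theorem isCompact_lexArgmin {E : Type*} [TopologicalSpace E] {l : List (E → ℝ)}
    (hl : ∀ g ∈ l, Continuous g) {K : Set E} (hK : IsCompact K) : IsCompact (lexArgmin l K) := by
  induction l generalizing K with
  | nil => exact hK
  | cons g l ih =>
    exact ih (fun a ha => hl a (List.mem_cons_of_mem _ ha))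
      (isCompact_argminOn hK (hl g List.mem_cons_self))

theorem lexArgmin_nonempty {E : Type*} [TopologicalSpace E] {l : List (E → ℝ)}
    (hl : ∀ g ∈ l, Continuous g) {K : Set E} (hK : IsCompact K) (hne : K.Nonempty) :
    (lexArgmin l K).Nonempty := by
  induction l generalizing K with
  | nil => exact hne
  | cons g l ih =>
    exact ih (fun a ha => hl a (List.mem_cons_of_mem _ ha))
      (isCompact_argminOn hK (hl g List.mem_cons_self))
      (argminOn_nonempty hK hne (hl g List.mem_cons_self))

theorem convex_argminOn {E : Type*} [AddCommGroup E] [Module ℝ E] {K : Set E} {g : E → ℝ}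
    (hg : ConvexOn ℝ K g) : Convex ℝ (argminOn g K) := by
  intro x hx y hy a b ha hb hab
  refine ⟨hg.1 hx.1 hy.1 ha hb hab, fun z hz => ?_⟩
  have h1 := hg.2 hx.1 hy.1 ha hb hab
  have h2 := hx.2 z hz
  have h3 := hy.2 z hz
  simp only [smul_eq_mul] at h1
  calc g (a • x + b • y) ≤ a * g x + b * g y := h1
    _ ≤ a * g z + b * g z := by gcongr
    _ = g z := by rw [← add_mul, hab, one_mul]

theorem convex_lexArgmin {E : Type*} [AddCommGroup E] [Module ℝ E] {l : List (E → ℝ)}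
    {K : Set E} (hK : Convex ℝ K) (hl : ∀ g ∈ l, ConvexOn ℝ K g) : Convex ℝ (lexArgmin l K) := by
  induction l generalizing K with
  | nil => exact hK
  | cons g l ih =>
    have h := convex_argminOn (hl g List.mem_cons_self)
    exact ih h fun a ha => (hl a (List.mem_cons_of_mem _ ha)).subset (fun x hx => hx.1) h

theorem StrictConvexOn.const_mul {E : Type*} [AddCommGroup E] [Module ℝ E] {X : Set E} {g : E → ℝ}
    (hg : StrictConvexOn ℝ X g) {c : ℝ} (hc : 0 < c) : StrictConvexOn ℝ X fun x => c * g x := by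
  refine ⟨hg.1, fun x hx y hy hne a b ha hb hab => ?_⟩
  have h := mul_lt_mul_of_pos_left (hg.2 hx hy hne ha hb hab) hc
  simp only [smul_eq_mul] at h ⊢
  linarith

section Program

variable {E : Type*} [NormedAddCommGroup E] [NormedSpace ℝ E] [FiniteDimensional ℝ E]
  [MeasurableSpace E] [BorelSpace E] {X : Set E} {Ω : Type*} [MeasurableSpace Ω]
  (P : Measure Ω) [IsProbabilityMeasure P]

/-- Each observation receives an independent uniform `u`, and its constraint is relaxed by `δ n *
u`. For given `x` and `ω` at most one `u` makes it tight, and `u` is an atomless label, so the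
nondegenerate bound applies for every `n`. Then `δ n` tends to `0`. -/
theorem measure_violation_le_of_strictConvexOn (hXc : IsCompact X) (hX : Convex ℝ X)
    (hint : (interior X).Nonempty) {f : E → Ω → ℝ} {γ : ℝ}
    (hmeas : Measurable fun p : X × Ω => f (p.1 : E) p.2)
    (hconv : ∀ ω, ConvexOn ℝ X fun x => f x ω)
    (hlsc : ∀ ω, LowerSemicontinuousOn (fun x => f x ω) X)
    (hfeas : ∃ x ∈ X, ∀ ω, f x ω ≤ γ) {h : E → ℝ} (hc : Continuous h)
    (hh : StrictConvexOn ℝ X h) (hd : 0 < Module.finrank ℝ E) {m : ℕ}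
    (hm : Module.finrank ℝ E ≤ m) {ε : ℝ} (hε : ε ∈ Set.Icc (0 : ℝ) 1) :
    (Measure.pi fun _ : Fin m => P)
      {s | ∃ x ∈ argminOn h (feasibleSet X (fun t x => f x (s t)) γ),
        ε < P.real {ω | γ < f x ω}} ≤ ENNReal.ofReal (binomTail (Module.finrank ℝ E) ε m) := by
  let Q : Measure (Ω × unitInterval) := P.prod volume
  let δ : ℕ → ℝ := fun n => 1 / ((n : ℝ) + 1)
  have hδ (n : ℕ) : 0 < δ n := Nat.one_div_pos_of_nat
  let F : ℕ → E → Ω × unitInterval → ℝ := fun n x z => f x z.1 + -(δ n * (z.2 : ℝ))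
  have hFmeas (n : ℕ) : Measurable fun p : X × (Ω × unitInterval) => F n (p.1 : E) p.2 := by
    refine Measurable.add ?_ (by fun_prop)
    exact hmeas.comp (measurable_fst.prodMk (measurable_fst.comp measurable_snd))
  have hFconv (n : ℕ) (z : Ω × unitInterval) : ConvexOn ℝ X fun x => F n x z :=
    (hconv z.1).add_const _
  have hFlsc (n : ℕ) (z : Ω × unitInterval) : LowerSemicontinuousOn (fun x => F n x z) X :=
    (hlsc z.1).add lowerSemicontinuousOn_const
  have hFle (n : ℕ) (x : E) (z : Ω × unitInterval) : F n x z ≤ f x z.1 := by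
    have := mul_nonneg (hδ n).le z.2.2.1
    show f x z.1 + -(δ n * (z.2 : ℝ)) ≤ f x z.1
    linarith
  have hFfeas (n : ℕ) : ∃ x ∈ X, ∀ z, F n x z ≤ γ := by
    obtain ⟨x, hx, hxf⟩ := hfeas
    exact ⟨x, hx, fun z => (hFle n x z).trans (hxf _)⟩
  have hnull {A : Set (Ω × unitInterval)} (hA : MeasurableSet A)
      (hs : ∀ ω, {u | (ω, u) ∈ A}.Subsingleton) : Q A = 0 :=
    (Measure.measure_prod_null hA).2 (.of_forall fun ω => (hs ω).measure_zero _)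
  have hbound (n : ℕ) := measure_violation_le_of_nondegenerate (γ := γ) Q hXc hX hint
    (hFmeas n) (hFconv n) (hFlsc n) (hFfeas n) hc hh
    (ℓ := fun z => (z.2 : ℝ)) (by fun_prop)
    (fun c => hnull (measurableSet_eq_fun (by fun_prop) measurable_const)
      fun ω u hu v hv => Subtype.ext (Eq.trans hu (Eq.symm hv)))
    (fun x hx => hnull
      (measurableSet_eq_fun (measurable_section (hFmeas n) hx) measurable_const)
      fun ω u hu v hv => Subtype.ext (by
        have h1 : f x ω + -(δ n * (u : ℝ)) = γ := hu
        have h2 : f x ω + -(δ n * (v : ℝ)) = γ := hv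
        exact mul_left_cancel₀ (hδ n).ne' (by linarith))) hd hm hε
  have hlimit := measure_violation_le_of_limit (P := Q)
    (sol := fun s : Fin m → Ω × unitInterval =>
      argminOn h (feasibleSet X (fun t x => f x (s t).1) γ))
    (viol := fun x => {z | γ < f x z.1}) hε.1 (fun s x hx => ?_) hbound
  · have hviol (x : E) : Q.real {z | γ < f x z.1} = P.real {ω | γ < f x ω} := by
      have : {z : Ω × unitInterval | γ < f x z.1} = {ω | γ < f x ω} ×ˢ Set.univ := by
        ext z; simp
      rw [this, measureReal_def, Measure.prod_prod, measure_univ, mul_one, measureReal_def]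
    simp only [hviol] at hlimit
    -- In the limit the event no longer involves the auxiliary uniform coordinates, so they
    -- integrate out.
    have hmp := measurePreserving_arrowProdEquivProdArrow Ω unitInterval (Fin m)
      (fun _ => P) (fun _ => volume)
    have hset : {s : Fin m → Ω × unitInterval |
        ∃ x ∈ argminOn h (feasibleSet X (fun t x => f x (s t).1) γ), ε < P.real {ω | γ < f x ω}}
        = MeasurableEquiv.arrowProdEquivProdArrow Ω unitInterval (Fin m) ⁻¹'
          ({s : Fin m → Ω | ∃ x ∈ argminOn h (feasibleSet X (fun t x => f x (s t)) γ),
            ε < P.real {ω | γ < f x ω}} ×ˢ Set.univ) := by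
      ext s
      rw [Set.mem_preimage, Set.mem_prod]
      exact (and_iff_left trivial).symm
    rw [hset, hmp.measure_preimage_equiv, Measure.prod_prod, measure_univ, mul_one] at hlimit
    exact hlimit
  · have hne (n : ℕ) : ∃ y, y ∈ argminOn h (feasibleSet X (fun t x => F n x (s t)) γ) :=
      argminOn_nonempty (isCompact_feasibleSet hXc fun t => hFlsc n (s t))
        ⟨x, hx.1.1, fun t => (hFle n x (s t)).trans (hx.1.2 t)⟩ hc
    choose u hu using hne
    refine ⟨u, hu, fun z hz => ?_⟩
    have hδlim : Filter.Tendsto δ Filter.atTop (nhds 0) := tendsto_one_div_add_atTop_nhds_zero_nat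
    have hδz (v : unitInterval) :
        Filter.Tendsto (fun n => δ n * (v : ℝ)) Filter.atTop (nhds 0) := by
      simpa using hδlim.mul_const (v : ℝ)
    have hu' : Filter.Tendsto u Filter.atTop (nhds x) :=
      tendsto_argminOn_relaxed hXc hX (fun t => hconv (s t).1) (fun t => hlsc (s t).1) hc hh
        (r := fun n t => δ n * ((s t).2 : ℝ))
        (fun n t => mul_nonneg (hδ n).le (s t).2.2.1) (fun t => hδz (s t).2) hx hu
    have huX : Filter.Tendsto u Filter.atTop (nhdsWithin x X) :=
      tendsto_nhdsWithin_iff.2 ⟨hu', .of_forall fun n => (hu n).1.1⟩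
    obtain ⟨b, hb1, hb2⟩ := exists_between (show γ < f x z.1 from hz)
    filter_upwards [huX.eventually (hlsc z.1 x hx.1.1 b hb2),
      (hδz z.2).eventually_lt_const (sub_pos.2 hb1)] with n h1 h2
    show γ < f (u n) z.1 + -(δ n * (z.2 : ℝ))
    linarith

/-- The last two objectives `a`, `g` are merged into the strictly convex `a + η n * g`, which
shortens the list by one; `η n` then tends to `0`. -/
theorem measure_violation_lexArgmin_le (hXc : IsCompact X) (hX : Convex ℝ X)
    (hint : (interior X).Nonempty) {f : E → Ω → ℝ} {γ : ℝ}
    (hmeas : Measurable fun p : X × Ω => f (p.1 : E) p.2)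
    (hconv : ∀ ω, ConvexOn ℝ X fun x => f x ω)
    (hlsc : ∀ ω, LowerSemicontinuousOn (fun x => f x ω) X)
    (hfeas : ∃ x ∈ X, ∀ ω, f x ω ≤ γ) {l : List (E → ℝ)}
    (hl : ∀ a ∈ l, Continuous a ∧ ConvexOn ℝ X a) {g : E → ℝ} (hg : Continuous g)
    (hgX : StrictConvexOn ℝ X g) (hd : 0 < Module.finrank ℝ E) {m : ℕ}
    (hm : Module.finrank ℝ E ≤ m) {ε : ℝ} (hε : ε ∈ Set.Icc (0 : ℝ) 1) :
    (Measure.pi fun _ : Fin m => P)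
      {s | ∃ x ∈ lexArgmin (l ++ [g]) (feasibleSet X (fun t x => f x (s t)) γ),
        ε < P.real {ω | γ < f x ω}} ≤ ENNReal.ofReal (binomTail (Module.finrank ℝ E) ε m) := by
  induction l using List.reverseRecOn generalizing g with
  | nil =>
    exact measure_violation_le_of_strictConvexOn P hXc hX hint hmeas hconv hlsc hfeas hg hgX hd hm hε
  | append_singleton l a ih =>
    let η : ℕ → ℝ := fun n => 1 / ((n : ℝ) + 1)
    have hη (n : ℕ) : 0 < η n := Nat.one_div_pos_of_nat
    have hl' : ∀ b ∈ l, Continuous b ∧ ConvexOn ℝ X b := fun b hb => hl b (by simp [hb])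
    obtain ⟨ha, haX⟩ := hl a (by simp)
    have hcont (n : ℕ) : Continuous fun x => a x + η n * g x := by fun_prop
    refine measure_violation_le_of_limit (viol := fun x => {ω | γ < f x ω})
      (viols := fun _ x => {ω | γ < f x ω}) hε.1 (fun s x hx => ?_)
      (fun n => ih hl' (hcont n) (haX.add_strictConvexOn (hgX.const_mul (hη n))))
    set K := feasibleSet X (fun t x => f x (s t)) γ
    have hKX : K ⊆ X := fun y hy => hy.1
    have hKconv : Convex ℝ K := convex_feasibleSet hX fun t => hconv (s t)
    rw [lexArgmin_append, lexArgmin_append] at hx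
    set K' := lexArgmin l K
    have hK'c : IsCompact K' := isCompact_lexArgmin (fun b hb => (hl' b hb).1)
      (isCompact_feasibleSet hXc fun t => hlsc (s t))
    have hK'X : K' ⊆ X := (lexArgmin_subset l K).trans hKX
    have hK'conv : Convex ℝ K' :=
      convex_lexArgmin hKconv fun b hb => (hl' b hb).2.subset hKX hKconv
    change x ∈ argminOn g (argminOn a K') at hx
    have hne (n : ℕ) : ∃ y, y ∈ argminOn (fun x => a x + η n * g x) K' :=
      argminOn_nonempty hK'c ⟨x, hx.1.1⟩ (hcont n)
    choose u hu using hne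
    have hargconv : Convex ℝ (argminOn a K') := convex_argminOn (haX.subset hK'X hK'conv)
    have hlim : Filter.Tendsto u Filter.atTop (nhds x) :=
      tendsto_argminOn_add_mul hK'c ha hg hx
        (fun y hy => argminOn_eq_of_strictConvexOn
          (hgX.subset (fun z hz => hK'X hz.1) hargconv) hy hx)
        hη tendsto_one_div_add_atTop_nhds_zero_nat hu
    have huX : Filter.Tendsto u Filter.atTop (nhdsWithin x X) :=
      tendsto_nhdsWithin_iff.2 ⟨hlim, .of_forall fun n => hK'X (hu n).1⟩
    refine ⟨u, fun n => ?_, fun z hz => huX.eventually (hlsc z x (hK'X hx.1.1) γ hz)⟩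
    rw [lexArgmin_append]
    exact hu n

end Program

/-! ### Lexicographic comparison along a list of objectives -/

/-- `y` precedes `x` in the lexicographic order of the values of a list of objectives. -/
def LexLt {E : Type*} : List (E → ℝ) → E → E → Prop
  | [], _, _ => False
  | g :: l, y, x => g y < g x ∨ (g y = g x ∧ LexLt l y x)

theorem mem_lexArgmin_iff {E : Type*} {l : List (E → ℝ)} {K : Set E} {x : E} :
    x ∈ lexArgmin l K ↔ x ∈ K ∧ ∀ y ∈ K, ¬ LexLt l y x := by
  induction l generalizing K with
  | nil => simp [lexArgmin, LexLt]
  | cons g l ih =>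
    rw [lexArgmin, ih]
    constructor
    · rintro ⟨hx, h⟩
      refine ⟨hx.1, fun y hy => ?_⟩
      rintro (hlt | ⟨heq, hl⟩)
      · exact absurd (hx.2 y hy) (not_le.2 hlt)
      · exact h y ⟨hy, fun z hz => heq.le.trans (hx.2 z hz)⟩ hl
    · rintro ⟨hx, h⟩
      have hmin : ∀ y ∈ K, g x ≤ g y := fun y hy => not_lt.1 fun hlt => h y hy (Or.inl hlt)
      exact ⟨⟨hx, hmin⟩, fun y hy hl =>
        h y hy.1 (Or.inr ⟨le_antisymm (hy.2 x hx) (hmin y hy.1), hl⟩)⟩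

theorem eq_of_not_lexLt {E : Type*} {l : List (E → ℝ)} {x y : E} (h1 : ¬ LexLt l y x)
    (h2 : ¬ LexLt l x y) : ∀ g ∈ l, g x = g y := by
  induction l with
  | nil => simp
  | cons g l ih =>
    simp only [LexLt, not_or, not_and] at h1 h2
    have heq : g x = g y := le_antisymm (not_lt.1 h1.1) (not_lt.1 h2.1)
    intro a ha
    rcases List.mem_cons.1 ha with rfl | ha
    · exact heq
    · exact ih (h1.2 heq.symm) (h2.2 heq) a ha

theorem lexLt_ofFn_iff {E : Type*} {n : ℕ} (F : Fin n → E → ℝ) (y x : E) :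
    LexLt (List.ofFn F) y x ↔ ∃ k, F k y < F k x ∧ ∀ j < k, F j y = F j x := by
  induction n with
  | zero => simp [LexLt]
  | succ n ih =>
    rw [List.ofFn_succ, LexLt, ih, Fin.exists_fin_succ]
    refine or_congr (by simp) ?_
    simp only [Fin.forall_fin_succ, Fin.succ_lt_succ_iff, Fin.succ_pos, true_imp_iff]
    exact ⟨fun ⟨h0, k, h1, h2⟩ => ⟨k, h1, h0, h2⟩, fun ⟨k, h1, h0, h2⟩ => ⟨h0, k, h1, h2⟩⟩

/-! ### Matrices as decision variables -/

section Matrices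

instance matrixBorelSpace (N : ℕ) : BorelSpace (Matrix (Fin N) (Fin N) ℝ) :=
  inferInstanceAs (BorelSpace (Fin N → Fin N → ℝ))

attribute [local instance] Matrix.normedAddCommGroup Matrix.normedSpace

variable {N : ℕ}

theorem matrixBorelSpace_norm (N : ℕ) :
    @BorelSpace (Matrix (Fin N) (Fin N) ℝ)
      (Matrix.normedAddCommGroup.toPseudoMetricSpace.toUniformSpace.toTopologicalSpace) _ :=
  matrixBorelSpace N

/-- The entries of a matrix, read row by row. -/
def matrixEntries (N : ℕ) : List (Matrix (Fin N) (Fin N) ℝ → ℝ) :=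
  List.ofFn fun (k : Fin (N * N)) ζ => ζ (finProdFinEquiv.symm k).1 (finProdFinEquiv.symm k).2

/-- The objectives that define the solution of a program with linear cost. -/
def preferenceObjectives (c : Matrix (Fin N) (Fin N) ℝ) :
    List (Matrix (Fin N) (Fin N) ℝ → ℝ) :=
  linearCost c :: matrixEntries N

theorem finProdFinEquiv_lt_iff (i i' j j' : Fin N) :
    finProdFinEquiv (i', j') < finProdFinEquiv (i, j) ↔ i' < i ∨ (i' = i ∧ j' < j) := by
  simp only [Fin.lt_def, Fin.ext_iff, finProdFinEquiv_apply_val]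
  have hj := j.2
  have hj' := j'.2
  rcases lt_trichotomy (i' : ℕ) i with h | h | h
  · have := Nat.mul_le_mul_left N (Nat.succ_le_of_lt h)
    rw [Nat.mul_succ] at this
    omega
  · rw [h]; omega
  · have := Nat.mul_le_mul_left N (Nat.succ_le_of_lt h)
    rw [Nat.mul_succ] at this
    omega

theorem preferred_iff_lexLt (c ζ ζ' : Matrix (Fin N) (Fin N) ℝ) :
    Preferred c ζ ζ' ↔ LexLt (preferenceObjectives c) ζ ζ' := by
  rw [Preferred, preferenceObjectives, LexLt, matrixEntries, lexLt_ofFn_iff]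
  refine or_congr_right (and_congr_right fun _ => ?_)
  constructor
  · rintro ⟨i, j, hlt, h⟩
    refine ⟨finProdFinEquiv (i, j), by simpa using hlt, fun k hk => ?_⟩
    obtain ⟨⟨i', j'⟩, rfl⟩ := finProdFinEquiv.surjective k
    simpa using h i' j' ((finProdFinEquiv_lt_iff i i' j j').1 hk)
  · rintro ⟨k, hlt, h⟩
    obtain ⟨⟨i, j⟩, rfl⟩ := finProdFinEquiv.surjective k
    refine ⟨i, j, by simpa using hlt, fun i' j' hij => ?_⟩
    simpa using h _ ((finProdFinEquiv_lt_iff i i' j j').2 hij)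

theorem isSolution_iff_mem_lexArgmin (c : Matrix (Fin N) (Fin N) ℝ)
    (S : Set (Matrix (Fin N) (Fin N) ℝ)) (ζ : Matrix (Fin N) (Fin N) ℝ) :
    IsSolution c S ζ ↔ ζ ∈ lexArgmin (preferenceObjectives c) S := by
  rw [mem_lexArgmin_iff, IsSolution]
  simp only [preferred_iff_lexLt]

theorem IsSolution.eq {c : Matrix (Fin N) (Fin N) ℝ} {S : Set (Matrix (Fin N) (Fin N) ℝ)}
    {ζ ζ' : Matrix (Fin N) (Fin N) ℝ} (h : IsSolution c S ζ) (h' : IsSolution c S ζ') :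
    ζ = ζ' := by
  have h1 := h.2 ζ' h'.1
  have h2 := h'.2 ζ h.1
  rw [preferred_iff_lexLt] at h1 h2
  ext i j
  have h3 := eq_of_not_lexLt h1 h2 (fun ζ => ζ i j) (List.mem_cons_of_mem _
    ((List.mem_ofFn' _ _).2 ⟨finProdFinEquiv (i, j), by simp⟩))
  exact h3

theorem linearCost_combo (c x y : Matrix (Fin N) (Fin N) ℝ) (a b : ℝ) :
    linearCost c (a • x + b • y) = a * linearCost c x + b * linearCost c y := by
  simp only [linearCost, Matrix.add_apply, Matrix.smul_apply, smul_eq_mul, Finset.mul_sum,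
    ← Finset.sum_add_distrib]
  exact Finset.sum_congr rfl fun i _ => Finset.sum_congr rfl fun j _ => by ring

theorem preferenceObjectives_continuous_convexOn {X : Set (Matrix (Fin N) (Fin N) ℝ)}
    (hX : Convex ℝ X) (c : Matrix (Fin N) (Fin N) ℝ) :
    ∀ a ∈ preferenceObjectives c, Continuous a ∧ ConvexOn ℝ X a := by
  intro a ha
  rcases List.mem_cons.1 ha with rfl | ha
  · refine ⟨?_, hX, fun x _ y _ r s _ _ _ => (linearCost_combo c x y r s).le⟩
    exact continuous_finsetSum _ fun i _ => continuous_finsetSum _ fun j _ =>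
      continuous_const.mul (continuous_id.matrix_elem i j)
  · obtain ⟨k, rfl⟩ := (List.mem_ofFn' _ _).1 ha
    exact ⟨continuous_id.matrix_elem _ _, hX, fun x _ y _ r s _ _ _ => le_rfl⟩

/-- The sum of the squares of the entries. -/
def sumSqEntries (ζ : Matrix (Fin N) (Fin N) ℝ) : ℝ := ∑ i, ∑ j, ζ i j ^ 2

theorem continuous_sumSqEntries : Continuous (sumSqEntries (N := N)) :=
  continuous_finsetSum _ fun i _ => continuous_finsetSum _ fun j _ =>
    (continuous_id.matrix_elem i j).pow 2

theorem strictConvexOn_sumSqEntries {X : Set (Matrix (Fin N) (Fin N) ℝ)} (hX : Convex ℝ X) :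
    StrictConvexOn ℝ X (sumSqEntries (N := N)) := by
  refine ⟨hX, fun x _ y _ hne a b ha hb hab => ?_⟩
  have hpos : 0 < sumSqEntries (x - y) := by
    obtain ⟨i, j, hij⟩ : ∃ i j, x i j ≠ y i j := by
      by_contra! h; exact hne (Matrix.ext h)
    refine Finset.sum_pos' (fun i _ => Finset.sum_nonneg fun j _ => sq_nonneg _)
      ⟨i, Finset.mem_univ i, Finset.sum_pos' (fun j _ => sq_nonneg _)
        ⟨j, Finset.mem_univ j, ?_⟩⟩
    exact sq_pos_of_ne_zero (sub_ne_zero.2 hij)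
  have hid : sumSqEntries (a • x + b • y)
      = a * sumSqEntries x + b * sumSqEntries y - a * b * sumSqEntries (x - y) := by
    obtain rfl : a = 1 - b := by linarith
    simp only [sumSqEntries, Matrix.add_apply, Matrix.smul_apply, Matrix.sub_apply, smul_eq_mul,
      Finset.mul_sum, ← Finset.sum_add_distrib, ← Finset.sum_sub_distrib]
    exact Finset.sum_congr rfl fun i _ => Finset.sum_congr rfl fun j _ => by ring
  rw [hid, smul_eq_mul, smul_eq_mul]
  have := mul_pos (mul_pos ha hb) hpos
  linarith

theorem existsUnique_isSolution (c : Matrix (Fin N) (Fin N) ℝ)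
    {S : Set (Matrix (Fin N) (Fin N) ℝ)} (hS : IsCompact S) (hne : S.Nonempty) :
    ∃! ζ, IsSolution c S ζ := by
  refine existsUnique_of_exists_of_unique ?_ fun ζ ζ' h h' => h.eq h'
  obtain ⟨ζ, hζ⟩ := lexArgmin_nonempty (fun a ha =>
    (preferenceObjectives_continuous_convexOn (X := Set.univ) convex_univ c a ha).1) hS hne
  exact ⟨ζ, (isSolution_iff_mem_lexArgmin c S ζ).2 hζ⟩

/-- The entries already single out one point, so the strictly convex final objective required by
`measure_violation_lexArgmin_le` can be appended without changing the solution. -/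
theorem IsSolution.mem_lexArgmin_append {c : Matrix (Fin N) (Fin N) ℝ}
    {S : Set (Matrix (Fin N) (Fin N) ℝ)} {ζ : Matrix (Fin N) (Fin N) ℝ} (h : IsSolution c S ζ)
    (g : Matrix (Fin N) (Fin N) ℝ → ℝ) : ζ ∈ lexArgmin (preferenceObjectives c ++ [g]) S := by
  rw [lexArgmin_append]
  refine ⟨(isSolution_iff_mem_lexArgmin c S ζ).1 h, fun y hy => ?_⟩
  rw [h.eq ((isSolution_iff_mem_lexArgmin c S y).2 hy)]

/-! ### Random convex programs over matrices -/

variable {X : Set (Matrix (Fin N) (Fin N) ℝ)} {Ω : Type*} [MeasurableSpace Ω] (P : Measure Ω)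
  [IsProbabilityMeasure P] {f : Matrix (Fin N) (Fin N) ℝ → Ω → ℝ} {γ : ℝ}

theorem ae_existsUnique_isSolution (hXc : IsCompact X)
    (hlsc : ∀ ω, LowerSemicontinuousOn (fun ζ => f ζ ω) X)
    (hfeas : ∃ ζ₀ ∈ X, ∀ᵐ ω ∂P, f ζ₀ ω ≤ γ) (c : Matrix (Fin N) (Fin N) ℝ) (m : ℕ) :
    ∀ᵐ s ∂(Measure.pi fun _ : Fin m => P), ∃! ζ, IsSolution c (sampledFeasible X f γ s) ζ := by
  obtain ⟨ζ₀, hζ₀, hζ₀f⟩ := hfeas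
  have hall : ∀ᵐ s ∂(Measure.pi fun _ : Fin m => P), ∀ t, f ζ₀ (s t) ≤ γ :=
    ae_all_iff.2 fun t => (Measure.quasiMeasurePreserving_eval (fun _ : Fin m => P) t).ae hζ₀f
  filter_upwards [hall] with s hs
  exact existsUnique_isSolution c
    (isCompact_feasibleSet (G := fun t ζ => f ζ (s t)) hXc fun t => hlsc (s t)) ⟨ζ₀, hζ₀, hs⟩

theorem measure_violationProb_le (hXc : IsCompact X) (hX : Convex ℝ X)
    (hint : (interior X).Nonempty)
    (hmeas : Measurable fun p : X × Ω => f (p.1 : Matrix (Fin N) (Fin N) ℝ) p.2)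
    (hconv : ∀ ω, ConvexOn ℝ X fun ζ => f ζ ω)
    (hlsc : ∀ ω, LowerSemicontinuousOn (fun ζ => f ζ ω) X)
    (hfeas : ∃ ζ₀ ∈ X, ∀ᵐ ω ∂P, f ζ₀ ω ≤ γ) (c : Matrix (Fin N) (Fin N) ℝ) {m : ℕ}
    (hm : N ^ 2 ≤ m) {ε : ℝ} (hε : ε ∈ Set.Icc (0 : ℝ) 1) :
    (Measure.pi fun _ : Fin m => P)
      {s | ∃ ζ, IsSolution c (sampledFeasible X f γ s) ζ ∧ ε < violationProb P f γ ζ}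
      ≤ ENNReal.ofReal (tailBound N ε m) := by
  classical
  obtain ⟨ζ₀, hζ₀, hζ₀f⟩ := hfeas
  -- For `N = 0` the tail is an empty sum, so the event itself must be null: the only decision is
  -- `ζ₀`, which is almost surely not violated.
  rcases Nat.eq_zero_or_pos N with rfl | hN
  · have hempty : {s : Fin m → Ω | ∃ ζ, IsSolution c (sampledFeasible X f γ s) ζ ∧
        ε < violationProb P f γ ζ} = ∅ := by
      refine Set.eq_empty_of_forall_notMem fun s ⟨ζ, _, hlt⟩ => ?_
      have h0 : violationProb P f γ ζ = 0 := by
        rw [Subsingleton.elim ζ ζ₀, violationProb, measureReal_def]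
        have : P {ω | γ < f ζ₀ ω} = 0 := by
          have := ae_iff.1 hζ₀f
          simpa only [not_le] using this
        rw [this, ENNReal.toReal_zero]
      linarith [hε.1]
    rw [hempty, measure_empty]
    exact bot_le
  have hrank : Module.finrank ℝ (Matrix (Fin N) (Fin N) ℝ) = N ^ 2 := by
    rw [Module.finrank_matrix]; simp [sq]
  -- On the null set of `ω` where `ζ₀` is infeasible the constraint is replaced by the constant `γ`.
  -- Then `ζ₀` is feasible for every `ω`, and almost surely nothing else changes.
  let f' : Matrix (Fin N) (Fin N) ℝ → Ω → ℝ := fun ζ ω => if f ζ₀ ω ≤ γ then f ζ ω else γ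
  have hmeas' : Measurable fun p : X × Ω => f' (p.1 : Matrix (Fin N) (Fin N) ℝ) p.2 :=
    Measurable.ite (measurableSet_le ((measurable_section hmeas hζ₀).comp measurable_snd)
      measurable_const) hmeas measurable_const
  have hconv' (ω : Ω) : ConvexOn ℝ X fun ζ => f' ζ ω := by
    by_cases h : f ζ₀ ω ≤ γ
    · simpa only [f', h, if_true] using hconv ω
    · simpa only [f', h, if_false] using convexOn_const γ hX
  have hlsc' (ω : Ω) : LowerSemicontinuousOn (fun ζ => f' ζ ω) X := by
    by_cases h : f ζ₀ ω ≤ γ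
    · simpa only [f', h, if_true] using hlsc ω
    · simpa only [f', h, if_false] using lowerSemicontinuousOn_const
  have hfeas' : ∃ ζ ∈ X, ∀ ω, f' ζ ω ≤ γ := by
    refine ⟨ζ₀, hζ₀, fun ω => ?_⟩
    by_cases h : f ζ₀ ω ≤ γ
    · simp only [f', h, if_true]
    · simp only [f', h, if_false, le_refl]
  have := matrixBorelSpace_norm N
  have hbound := measure_violation_lexArgmin_le P hXc hX hint hmeas' hconv' hlsc' hfeas'
    (preferenceObjectives_continuous_convexOn hX c) continuous_sumSqEntries
    (strictConvexOn_sumSqEntries hX) (by rw [hrank]; positivity) (hrank.le.trans hm) hε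
  rw [hrank] at hbound
  refine le_trans (measure_mono_ae ?_) hbound
  have hall : ∀ᵐ s ∂(Measure.pi fun _ : Fin m => P), ∀ t, f ζ₀ (s t) ≤ γ :=
    ae_all_iff.2 fun t => (Measure.quasiMeasurePreserving_eval (fun _ : Fin m => P) t).ae hζ₀f
  filter_upwards [hall] with s hs hsol
  obtain ⟨ζ, hζ, hlt⟩ := hsol
  have hset : feasibleSet X (fun t x => f' x (s t)) γ = sampledFeasible X f γ s := by
    ext x
    simp only [feasibleSet, sampledFeasible, f', hs, if_true]
  refine ⟨ζ, ?_, hlt.trans_eq (measureReal_congr ?_)⟩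
  · rw [hset]
    exact hζ.mem_lexArgmin_append _
  · filter_upwards [hζ₀f] with ω hω
    have he : f' ζ ω = f ζ ω := by simp only [f', hω, if_true]
    exact congrArg (fun r => γ < r) he.symm

end Matrices

/-! ### The appraisal loss -/

section Appraisal

variable {N : ℕ} (ρ : Fin N → ℝ) (L Q : Matrix (Fin N) (Fin N) ℝ)

theorem opinionResidual_combo (x y : Matrix (Fin N) (Fin N) ℝ) (z : Observation N) {a b : ℝ}
    (hab : a + b = 1) : opinionResidual ρ L (a • x + b • y) z
      = a • opinionResidual ρ L x z + b • opinionResidual ρ L y z := by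
  obtain rfl : a = 1 - b := by linarith
  simp only [opinionResidual, Matrix.mul_add, Matrix.mul_smul, Matrix.add_mulVec,
    Matrix.smul_mulVec]
  module

variable {Q}

theorem appraisalLoss_nonneg (hQ : Q.PosDef) (ζ : Matrix (Fin N) (Fin N) ℝ) (z : Observation N) :
    0 ≤ appraisalLoss ρ L Q ζ z := by
  have := hQ.posSemidef.dotProduct_mulVec_nonneg (opinionResidual ρ L ζ z)
  simpa [appraisalLoss] using this

theorem convexOn_appraisalLoss (hQ : Q.PosDef) {X : Set (Matrix (Fin N) (Fin N) ℝ)}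
    (hX : Convex ℝ X) (z : Observation N) : ConvexOn ℝ X fun ζ => appraisalLoss ρ L Q ζ z := by
  refine ⟨hX, fun x _ y _ a b ha hb hab => ?_⟩
  simp only [appraisalLoss]
  rw [opinionResidual_combo ρ L x y z hab]
  set v := opinionResidual ρ L x z
  set w := opinionResidual ρ L y z
  -- The convexity gap of the quadratic form is exactly `a * b` times its value at `v - w`.
  have hq : 0 ≤ (v - w) ⬝ᵥ Q.mulVec (v - w) := by
    simpa using hQ.posSemidef.dotProduct_mulVec_nonneg (v - w)
  obtain rfl : a = 1 - b := by linarith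
  simp only [Matrix.mulVec_add, Matrix.mulVec_sub, Matrix.mulVec_smul, dotProduct_add,
    add_dotProduct, dotProduct_sub, sub_dotProduct, smul_dotProduct, dotProduct_smul,
    smul_eq_mul] at hq ⊢
  nlinarith [mul_nonneg (mul_nonneg ha hb) hq]

theorem continuous_appraisalLoss :
    Continuous fun p : Matrix (Fin N) (Fin N) ℝ × Observation N => appraisalLoss ρ L Q p.1 p.2 := by
  have h : Continuous fun p : Matrix (Fin N) (Fin N) ℝ × Observation N =>
      opinionResidual ρ L p.1 p.2 :=
    (continuous_snd.snd.sub continuous_snd.fst).add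
      ((continuous_const.matrix_mul continuous_fst).matrix_mulVec continuous_snd.fst)
  exact h.dotProduct (continuous_const.matrix_mulVec h)

variable {ρ L} {D : Matrix (Fin N) (Fin N) ℝ}

theorem appraisalLoss_eq_zero {z : Observation N}
    (hz : z.2 = (1 - Matrix.diagonal ρ * L * D).mulVec z.1) : appraisalLoss ρ L Q D z = 0 := by
  have : opinionResidual ρ L D z = 0 := by
    rw [opinionResidual, hz, Matrix.sub_mulVec, Matrix.one_mulVec]; abel
  rw [appraisalLoss, this, zero_dotProduct]

theorem empiricalLoss_le_zero_iff (hQ : Q.PosDef) {m : ℕ} (s : Fin m → Observation N)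
    (ζ : Matrix (Fin N) (Fin N) ℝ) :
    empiricalLoss ρ L Q s ζ ≤ 0 ↔ ∀ t, appraisalLoss ρ L Q ζ (s t) ≤ 0 := by
  have hnn (t : Fin m) : 0 ≤ appraisalLoss ρ L Q ζ (s t) := appraisalLoss_nonneg ρ L hQ ζ (s t)
  constructor
  · intro h t
    -- The index `t` excludes `m = 0`, where `1 / m` is `0` by convention.
    have hm : (0 : ℝ) < 1 / m := by
      have : 0 < m := t.pos
      positivity
    have h1 : ∑ t, appraisalLoss ρ L Q ζ (s t) ≤ 0 := by
      by_contra! hlt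
      exact absurd h (not_le.2 (mul_pos hm hlt))
    exact (Finset.single_le_sum (fun t _ => hnn t) (Finset.mem_univ t)).trans h1
  · intro h
    exact mul_nonpos_of_nonneg_of_nonpos (by positivity) (Finset.sum_nonpos fun t _ => h t)

theorem optimalLevel_eq_zero (hQ : Q.PosDef) {m : ℕ} {s : Fin m → Observation N}
    (hs : ∀ t, (s t).2 = (1 - Matrix.diagonal ρ * L * D).mulVec (s t).1) :
    optimalLevel ρ L Q s = 0 := by
  refine IsLeast.csInf_eq ⟨⟨le_rfl, D, ?_⟩, fun γ hγ => hγ.1⟩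
  exact (empiricalLoss_le_zero_iff hQ s D).2 fun t => (appraisalLoss_eq_zero (hs t)).le

/-- Noise-free data make the level `0`, and a mean of nonnegative losses is at most `0` only if each
loss is. This reduces the estimation problem to a sampled convex program with a deterministic level.
-/
theorem appraisalFeasible_eq (hQ : Q.PosDef) (X : Set (Matrix (Fin N) (Fin N) ℝ)) {m : ℕ}
    {s : Fin m → Observation N}
    (hs : ∀ t, (s t).2 = (1 - Matrix.diagonal ρ * L * D).mulVec (s t).1) :
    appraisalFeasible X ρ L Q s = sampledFeasible X (appraisalLoss ρ L Q) 0 s := by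
  ext ζ
  simp only [appraisalFeasible, sampledFeasible, optimalLevel_eq_zero hQ hs,
    empiricalLoss_le_zero_iff hQ]

end Appraisal

/-! ### The theorem for random convex programs and for the appraisal matrix -/

theorem theorem4 (N : ℕ) (X : Set (Matrix (Fin N) (Fin N) ℝ))
    (hXcompact : IsCompact X) (hXconvex : Convex ℝ X) (hX0 : 0 ∈ interior X)
    (c : Matrix (Fin N) (Fin N) ℝ) :
    -- random convex programs with `N²` decision variables and a general constraint function
    (∀ (Ω : Type*) [MeasurableSpace Ω] (P : Measure Ω) [IsProbabilityMeasure P]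
        (f : Matrix (Fin N) (Fin N) ℝ → Ω → ℝ) (γ : ℝ),
      Measurable (fun p : X × Ω => f (p.1 : Matrix (Fin N) (Fin N) ℝ) p.2) →
      (∀ ω, ConvexOn ℝ X (fun ζ => f ζ ω)) →
      (∀ ω, LowerSemicontinuousOn (fun ζ => f ζ ω) X) →
      (∃ ζ₀ ∈ X, ∀ᵐ ω ∂P, f ζ₀ ω ≤ γ) →
      (∀ m : ℕ, N ^ 2 ≤ m →
        (∀ᵐ s ∂(Measure.pi fun _ : Fin m => P),
          ∃! ζ, IsSolution c (sampledFeasible X f γ s) ζ) ∧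
        ∀ ε ∈ Set.Icc (0 : ℝ) 1,
          (Measure.pi fun _ : Fin m => P)
              {s | ∃ ζ, IsSolution c (sampledFeasible X f γ s) ζ ∧
                ε < violationProb P f γ ζ}
            ≤ ENNReal.ofReal (tailBound N ε m)) ∧
      (∀ ε ∈ Set.Ioc (0 : ℝ) 1, ∀ β ∈ Set.Ioo (0 : ℝ) 1, ∀ m : ℕ, sampleSize N ε β ≤ m →
        (Measure.pi fun _ : Fin m => P)
            {s | ∃ ζ, IsSolution c (sampledFeasible X f γ s) ζ ∧
              ε < violationProb P f γ ζ}
          ≤ ENNReal.ofReal β)) ∧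
    -- the estimation of the appraisal matrix `D` from `m` observed pairs of opinions
    (∀ (ρ : Fin N → ℝ) (L D Q : Matrix (Fin N) (Fin N) ℝ), D ∈ X → Q.PosDef →
      ∀ (P : Measure (Observation N)) [IsProbabilityMeasure P],
      (∀ᵐ z ∂P, z.2 = (1 - Matrix.diagonal ρ * L * D).mulVec z.1) →
      (∀ m : ℕ, N ^ 2 ≤ m →
        (∀ᵐ s ∂(Measure.pi fun _ : Fin m => P),
          ∃! ζ, IsSolution c (appraisalFeasible X ρ L Q s) ζ) ∧
        ∀ ε ∈ Set.Icc (0 : ℝ) 1,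
          (Measure.pi fun _ : Fin m => P)
              {s | ∃ ζ, IsSolution c (appraisalFeasible X ρ L Q s) ζ ∧
                ε < violationProb P (appraisalLoss ρ L Q) (optimalLevel ρ L Q s) ζ}
            ≤ ENNReal.ofReal (tailBound N ε m)) ∧
      (∀ ε ∈ Set.Ioc (0 : ℝ) 1, ∀ β ∈ Set.Ioo (0 : ℝ) 1, ∀ m : ℕ, sampleSize N ε β ≤ m →
        (Measure.pi fun _ : Fin m => P)
            {s | ∃ ζ, IsSolution c (appraisalFeasible X ρ L Q s) ζ ∧
              ε < violationProb P (appraisalLoss ρ L Q) (optimalLevel ρ L Q s) ζ}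
          ≤ ENNReal.ofReal β)) ∧
    -- the sample size is the least number of observations that makes the bound at most `β`
    (∀ ε ∈ Set.Ioc (0 : ℝ) 1, ∀ β ∈ Set.Ioo (0 : ℝ) 1,
      IsLeast {m : ℕ | tailBound N ε m ≤ β} (sampleSize N ε β)) := by
  have hint : (interior X).Nonempty := ⟨0, hX0⟩
  refine ⟨fun Ω _ P _ f γ hmeas hconv hlsc hfeas => ⟨fun m hm => ⟨?_, fun ε hε => ?_⟩,
    fun ε hε β hβ m hm => ?_⟩, fun ρ L D Q hD hQ P _ hP => ?_,
    fun ε hε β hβ => isLeast_sampleSize N hε hβ⟩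
  · exact ae_existsUnique_isSolution P hXcompact hlsc hfeas c m
  · exact measure_violationProb_le P hXcompact hXconvex hint hmeas hconv hlsc hfeas c hm hε
  · exact (measure_violationProb_le P hXcompact hXconvex hint hmeas hconv hlsc hfeas c
      (sq_le_of_sampleSize_le hε hβ hm) ⟨hε.1.le, hε.2⟩).trans
      (ENNReal.ofReal_le_ofReal (tailBound_le_of_sampleSize_le hε hβ hm))
  · have hcont := continuous_appraisalLoss (Q := Q) ρ L
    have hmeas : Measurable fun p : X × Observation N =>
        appraisalLoss ρ L Q (p.1 : Matrix (Fin N) (Fin N) ℝ) p.2 :=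
      (hcont.comp (continuous_subtype_val.prodMap continuous_id)).measurable
    have hconv := convexOn_appraisalLoss ρ L hQ hXconvex
    have hlsc (z : Observation N) :
        LowerSemicontinuousOn (fun ζ => appraisalLoss ρ L Q ζ z) X :=
      (hcont.comp (continuous_id.prodMk continuous_const)).lowerSemicontinuous.lowerSemicontinuousOn _
    have hfeas : ∃ ζ₀ ∈ X, ∀ᵐ z ∂P, appraisalLoss ρ L Q ζ₀ z ≤ 0 :=
      ⟨D, hD, hP.mono fun z hz => (appraisalLoss_eq_zero hz).le⟩
    have hall (m : ℕ) : ∀ᵐ s ∂(Measure.pi fun _ : Fin m => P),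
        ∀ t, (s t).2 = (1 - Matrix.diagonal ρ * L * D).mulVec (s t).1 :=
      ae_all_iff.2 fun t => (Measure.quasiMeasurePreserving_eval (fun _ : Fin m => P) t).ae hP
    have hbound (m : ℕ) (hm : N ^ 2 ≤ m) (ε : ℝ) (hε : ε ∈ Set.Icc (0 : ℝ) 1) :
        (Measure.pi fun _ : Fin m => P)
          {s | ∃ ζ, IsSolution c (appraisalFeasible X ρ L Q s) ζ ∧
            ε < violationProb P (appraisalLoss ρ L Q) (optimalLevel ρ L Q s) ζ}
          ≤ ENNReal.ofReal (tailBound N ε m) := by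
      refine le_trans (measure_mono_ae ?_)
        (measure_violationProb_le P hXcompact hXconvex hint hmeas hconv hlsc hfeas c hm hε)
      filter_upwards [hall m] with s hs hsol
      obtain ⟨ζ, hζ, hlt⟩ := hsol
      rw [appraisalFeasible_eq hQ X hs] at hζ
      rw [optimalLevel_eq_zero hQ hs] at hlt
      exact ⟨ζ, hζ, hlt⟩
    refine ⟨fun m hm => ⟨?_, fun ε hε => hbound m hm ε hε⟩, fun ε hε β hβ m hm => ?_⟩
    · filter_upwards [ae_existsUnique_isSolution P hXcompact hlsc hfeas c m, hall m] with s h hs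
      rw [appraisalFeasible_eq hQ X hs]
      exact h
    · exact (hbound m (sq_le_of_sampleSize_le hε hβ hm) ε ⟨hε.1.le, hε.2⟩).trans
        (ENNReal.ofReal_le_ofReal (tailBound_le_of_sampleSize_le hε hβ hm))
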